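/- Let $n\ge 3$ and $h\in\mathbb C$, and suppose that $q=e^h$ is not a root of unity. Put $q^a=e^{ha}$, $[a]=\frac{q^a-q^{-a}}{q-q^{-1}}$ and $[a]_+=\frac{q^a+q^{-a}}{q-q^{-1}}$. The algebra $U'_q({\rm so}_n)$ is the associative unital algebra over $\mathbb C$ with generators $I_{i,i-1}$, $i=2,\dots,n$, and relations $$I_{i+1,i}I_{i,i-1}^2-(q+q^{-1})I_{i,i-1}I_{i+1,i}I_{i,i-1}+I_{i,i-1}^2I_{i+1,i}=-I_{i+1,i},$$ $$I_{i+1,i}^2I_{i,i-1}-(q+q^{-1})I_{i+1,i}I_{i,i-1}I_{i+1,i}+I_{i,i-1}I_{i+1,i}^2=-I_{i,i-1},$$ $$I_{i,i-1}I_{j,j-1}=I_{j,j-1}I_{i,i-1}\quad(|i-j|>1).$$ For an array $\xi=(m_{j,k})$, $2\le k\le n$, $1\le j\le\lfloor k/2\rfloor$, with rows ${\bf m}_k=(m_{j,k})_j$, put $l_{j,2p+1}=m_{j,2p+1}+p-j+1$ and $l_{j,2p}=m_{j,2p}+p-j$, and let $\xi^{\pm j}_k$ be $\xi$ with $m_{j,k}$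 replaced by $m_{j,k}\pm1$. Let $A^j_{2p}(\xi)$ and $B^j_{2p-1}(\xi)$ be square roots of $$\frac{\prod_{i=1}^p[l_{i,2p+1}+l_{j,2p}][l_{i,2p+1}-l_{j,2p}-1]\prod_{i=1}^{p-1}[l_{i,2p-1}+l_{j,2p}][l_{i,2p-1}-l_{j,2p}-1]}{\prod_{1\le i\le p,\,i\ne j}[l_{i,2p}+l_{j,2p}][l_{i,2p}-l_{j,2p}][l_{i,2p}+l_{j,2p}+1][l_{i,2p}-l_{j,2p}-1]},$$ $$\frac{\prod_{i=1}^p[l_{i,2p}+l_{j,2p-1}][l_{i,2p}-l_{j,2p-1}]\prod_{i=1}^{p-1}[l_{i,2p-2}+l_{j,2p-1}][l_{i,2p-2}-l_{j,2p-1}]}{\prod_{1\le i\le p-1,\,i\ne j}[l_{i,2p-1}+l_{j,2p-1}][l_{i,2p-1}-l_{j,2p-1}][l_{i,2p-1}+l_{j,2p-1}-1][l_{i,2p-1}-l_{j,2p-1}-1]},$$ respectively, and put $$C_{2p-1}(\xi)=\frac{\prod_{s=1}^p[l_{s,2p}]\prod_{s=1}^{p-1}[l_{s,2p-2}]}{\prod_{s=1}^{p-1}[l_{s,2p-1}][l_{s,2p-1}-1]},\qquad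 \hat C_{2p-1}(\xi)=\frac{\prod_{s=1}^p[l_{s,2p}]_+\prod_{s=1}^{p-1}[l_{s,2p-2}]_+}{\prod_{s=1}^{p-1}[l_{s,2p-1}]_+[l_{s,2p-1}-1]_+},$$ $$D_{2p}(\xi)=\frac{\prod_{i=1}^p[l_{i,2p+1}-\frac12]\prod_{i=1}^{p-1}[l_{i,2p-1}-\frac12]}{\prod_{i=1}^{p-1}[l_{i,2p}+\frac12][l_{i,2p}-\frac12]},$$ where $C_{2p-1}(\xi)$ is read as $0$ if its denominator vanishes. *Nonclassical type.* Let $\epsilon=(\epsilon_2,\dots,\epsilon_n)$ with $\epsilon_i=\pm1$, and let ${\bf m}_n=(m_{1,n},\dots,m_{\lfloor n/2\rfloor,n})$ have entries in $\mathbb Z+\frac12$ with $m_{1,n}\ge m_{2,n}\ge\dots\ge m_{\lfloor n/2\rfloor,n}\ge\frac12$. The space of $T_{\epsilon,{\bf m}_n}$ has as basis the vectors $|\xi\rangle$, where $\xi$ runs through the arrays with entries in $\mathbb Z+\frac12$ and last row ${\bf m}_n$ such that $m_{1,2p+1}\ge m_{1,2p}\ge m_{2,2p+1}\ge\dots\ge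 m_{p,2p+1}\ge m_{p,2p}\ge\frac12$ for $3\le 2p+1\le n$ and $m_{1,2p}\ge m_{1,2p-1}\ge m_{2,2p}\ge\dots\ge m_{p-1,2p-1}\ge m_{p,2p}$ for $4\le 2p\le n$. The generators act by $$T_{\epsilon,{\bf m}_n}(I_{2p+1,2p})|\xi\rangle=\delta_{m_{p,2p},1/2}\frac{\epsilon_{2p+1}}{q^{1/2}-q^{-1/2}}D_{2p}(\xi)|\xi\rangle+\sum_{j=1}^p\frac{A^j_{2p}(\xi)|\xi^{+j}_{2p}\rangle-A^j_{2p}(\xi^{-j}_{2p})|\xi^{-j}_{2p}\rangle}{q^{l_{j,2p}}-q^{-l_{j,2p}}},$$ $$T_{\epsilon,{\bf m}_n}(I_{2p,2p-1})|\xi\rangle=\sum_{j=1}^{p-1}\left(\frac{B^j_{2p-1}(\xi)\,|\xi^{+j}_{2p-1}\rangle}{[2l_{j,2p-1}-1][l_{j,2p-1}]_+}-\frac{B^j_{2p-1}(\xi^{-j}_{2p-1})\,|\xi^{-j}_{2p-1}\rangle}{[2l_{j,2p-1}-1][l_{j,2p-1}-1]_+}\right)+\epsilon_{2p}\hat C_{2p-1}(\xi)|\xi\rangle,$$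 where terms in which $\xi^{\pm j}_k$ is not one of these arrays are omitted. *Classical type.* Let ${\bf m}'_n=(m'_{1,n},\dots,m'_{\lfloor n/2\rfloor,n})$ have entries all in $\mathbb Z$ or all in $\mathbb Z+\frac12$, with $m'_{1,n}\ge\dots\ge m'_{p,n}\ge0$ if $n=2p+1$ and $m'_{1,n}\ge\dots\ge m'_{p-1,n}\ge|m'_{p,n}|$ if $n=2p$. The space of $T_{{\bf m}'_n}$ has as basis the vectors $|\xi\rangle$, where $\xi$ runs through the arrays with last row ${\bf m}'_n$ and entries congruent to those of ${\bf m}'_n$ modulo $\mathbb Z$ such that $m_{1,2p+1}\ge m_{1,2p}\ge m_{2,2p+1}\ge\dots\ge m_{p,2p+1}\ge m_{p,2p}\ge-m_{p,2p+1}$ for $3\le2p+1\le n$ and $m_{1,2p}\ge m_{1,2p-1}\ge m_{2,2p}\ge\dots\ge m_{p-1,2p-1}\ge|m_{p,2p}|$ for $4\le2p\le n$. With the same convention on omitted terms, the generators act by $$T_{{\bf m}'_n}(I_{2p+1,2p})|\xi\rangle=\sum_{j=1}^p\frac{A^j_{2p}(\xi)|\xi^{+j}_{2p}\rangle-A^j_{2p}(\xi^{-j}_{2p})|\xi^{-j}_{2p}\rangle}{q^{l_{j,2p}}+q^{-l_{j,2p}}},$$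 $$T_{{\bf m}'_n}(I_{2p,2p-1})|\xi\rangle=\sum_{j=1}^{p-1}\left(\frac{B^j_{2p-1}(\xi)\,|\xi^{+j}_{2p-1}\rangle}{[2l_{j,2p-1}-1][l_{j,2p-1}]}-\frac{B^j_{2p-1}(\xi^{-j}_{2p-1})\,|\xi^{-j}_{2p-1}\rangle}{[2l_{j,2p-1}-1][l_{j,2p-1}-1]}\right)+{\rm i}\,C_{2p-1}(\xi)|\xi\rangle.$$ A representation of $U'_q({\rm so}_n)$ is determined by the operators of the generators. It is irreducible if its space is nonzero and the only subspaces invariant under these operators are $0$ and the whole space; two representations are equivalent if a linear isomorphism of their spaces intertwines these operators. For a compatible choice of the square roots (for instance the positive ones if $q>0$) the above operators are known to satisfy the defining relations. The following holds for every choice of the square roots, which may be a different one for each representation. **Theorem.** (i) Each $T_{\epsilon,{\bf m}_n}$ is irreducible. (ii) If $(\epsilon,{\bf m}_n)\ne(\epsilon',{\bf m}'_n)$, then $T_{\epsilon,{\bf m}_n}$ and $T_{\epsilon',{\bf m}'_n}$ are not equivalent. (iii) No $T_{\epsilon,{\bf m}_n}$ is equivalent to a representation $T_{{\bf m}'_n}$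 of the classical type. -/

import Mathlib

namespace QSO

/-! ### The algebra `U'_q(so_n)` and its representations

`q = exp h` with `h : ℂ`, so that `q ^ a = exp (h * a)` is unambiguous for half-integral `a`. -/

/-- The power `q ^ a`, where `q = exp h`. -/
noncomputable def qpow (h : ℂ) (a : ℚ) : ℂ := Complex.exp (h * (a : ℂ))

/-- The `q`-number `[a] = (q ^ a - q ^ (-a)) / (q - q⁻¹)`. -/
noncomputable def qnum (h : ℂ) (a : ℚ) : ℂ :=
  (qpow h a - qpow h (-a)) / (qpow h 1 - qpow h (-1))

/-- The number `[a]₊ = (q ^ a + q ^ (-a)) / (q - q⁻¹)`. -/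
noncomputable def qnumPlus (h : ℂ) (a : ℚ) : ℂ :=
  (qpow h a + qpow h (-a)) / (qpow h 1 - qpow h (-1))

/-- The index `k ∈ {2, …, n}` stands for the generator `I_{k,k-1}`. -/
abbrev Gen (n : ℕ) : Type := Set.Icc 2 n

/-- The defining relations of `U'_q(so_n)` between the free generators. -/
inductive Rel (h : ℂ) (n : ℕ) :
    FreeAlgebra ℂ (Gen n) → FreeAlgebra ℂ (Gen n) → Prop
  | cubic₁ (i j : Gen n) (hij : (j : ℕ) = (i : ℕ) + 1) :
      Rel h n
        (FreeAlgebra.ι ℂ j * FreeAlgebra.ι ℂ i ^ 2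
          - (qpow h 1 + qpow h (-1)) •
              (FreeAlgebra.ι ℂ i * FreeAlgebra.ι ℂ j * FreeAlgebra.ι ℂ i)
          + FreeAlgebra.ι ℂ i ^ 2 * FreeAlgebra.ι ℂ j)
        (-FreeAlgebra.ι ℂ j)
  | cubic₂ (i j : Gen n) (hij : (j : ℕ) = (i : ℕ) + 1) :
      Rel h n
        (FreeAlgebra.ι ℂ j ^ 2 * FreeAlgebra.ι ℂ i
          - (qpow h 1 + qpow h (-1)) •
              (FreeAlgebra.ι ℂ j * FreeAlgebra.ι ℂ i * FreeAlgebra.ι ℂ j)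
          + FreeAlgebra.ι ℂ i * FreeAlgebra.ι ℂ j ^ 2)
        (-FreeAlgebra.ι ℂ i)
  | comm (i j : Gen n) (hij : 1 < |((i : ℕ) : ℤ) - ((j : ℕ) : ℤ)|) :
      Rel h n
        (FreeAlgebra.ι ℂ i * FreeAlgebra.ι ℂ j)
        (FreeAlgebra.ι ℂ j * FreeAlgebra.ι ℂ i)

/-- The algebra `U'_q(so_n)`. -/
abbrev Uq (h : ℂ) (n : ℕ) : Type := RingQuot (Rel h n)

/-- The generator `I_{k,k-1}` of `U'_q(so_n)`. -/
noncomputable def Uq.I (h : ℂ) (n : ℕ) (k : Gen n) : Uq h n :=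
  RingQuot.mkAlgHom ℂ (Rel h n) (FreeAlgebra.ι ℂ k)

/-- Irreducibility, for a representation given by the operators `T k` of the generators:
the space is nonzero and has no invariant subspaces besides `0` and the whole space. -/
def IsIrreducible {n : ℕ} {V : Type*} [AddCommGroup V] [Module ℂ V]
    (T : Gen n → Module.End ℂ V) : Prop :=
  Nontrivial V ∧
    ∀ W : Submodule ℂ V, (∀ k, ∀ v ∈ W, T k v ∈ W) → W = ⊥ ∨ W = ⊤

/-- Equivalence, for representations given by the operators of the generators:
there is a linear isomorphism that intertwines them. -/
def Equivalent {n : ℕ} {V V' : Type*} [AddCommGroup V] [Module ℂ V]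
    [AddCommGroup V'] [Module ℂ V']
    (T : Gen n → Module.End ℂ V) (T' : Gen n → Module.End ℂ V') : Prop :=
  ∃ φ : V ≃ₗ[ℂ] V', ∀ k v, φ (T k v) = T' k (φ v)

/-- For a representation `ρ` of the algebra `U'_q(so_n)`, invariance under the generators is
invariance under the whole algebra. -/
theorem Uq.invariant_iff {h : ℂ} {n : ℕ} {V : Type*} [AddCommGroup V] [Module ℂ V]
    (ρ : Uq h n →ₐ[ℂ] Module.End ℂ V) (W : Submodule ℂ V) :
    (∀ k, ∀ v ∈ W, ρ (Uq.I h n k) v ∈ W) ↔ ∀ u, ∀ v ∈ W, ρ u v ∈ W := by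
  refine ⟨fun H u => ?_, fun H k => H _⟩
  obtain ⟨x, rfl⟩ := RingQuot.mkAlgHom_surjective ℂ (Rel h n) u
  induction x using FreeAlgebra.induction with
  | grade0 r =>
    intro v hv
    rw [AlgHom.commutes, AlgHom.commutes, Module.algebraMap_end_apply]
    exact W.smul_mem r hv
  | grade1 k => exact H k
  | mul a b ha hb =>
    intro v hv
    rw [map_mul, map_mul]
    exact ha _ (hb v hv)
  | add a b ha hb =>
    intro v hv
    rw [map_add, map_add]
    exact W.add_mem (ha v hv) (hb v hv)

/-- For representations `ρ`, `ρ'` of the algebra `U'_q(so_n)`, intertwining the generators is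
intertwining the whole algebra. -/
theorem Uq.intertwines_iff {h : ℂ} {n : ℕ} {V V' : Type*} [AddCommGroup V] [Module ℂ V]
    [AddCommGroup V'] [Module ℂ V'] (ρ : Uq h n →ₐ[ℂ] Module.End ℂ V)
    (ρ' : Uq h n →ₐ[ℂ] Module.End ℂ V') (φ : V ≃ₗ[ℂ] V') :
    (∀ k v, φ (ρ (Uq.I h n k) v) = ρ' (Uq.I h n k) (φ v)) ↔
      ∀ u v, φ (ρ u v) = ρ' u (φ v) := by
  refine ⟨fun H u => ?_, fun H k => H _⟩
  obtain ⟨x, rfl⟩ := RingQuot.mkAlgHom_surjective ℂ (Rel h n) u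
  induction x using FreeAlgebra.induction with
  | grade0 r => intro v; simp
  | grade1 k => exact H k
  | mul a b ha hb =>
    intro v
    simp only [map_mul, Module.End.mul_apply, ha, hb]
  | add a b ha hb =>
    intro v
    simp only [map_add, LinearMap.add_apply, ha, hb]

/-! ### Tableaux and the coefficients of the formulas -/

/-- Arrays of numbers: `ξ k j` is the entry `m_{j,k}`, i.e. the `j`-th component of the row
`m_k`, where `2 ≤ k ≤ n` and `1 ≤ j ≤ k / 2` (entries elsewhere will be required to be `0`). -/
abbrev Tableau : Type := ℕ → ℕ → ℚ

/-- `(ξ)^{+j}_k` for `δ = 1` and `(ξ)^{-j}_k` for `δ = -1`. -/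
def shift (ξ : Tableau) (k j : ℕ) (δ : ℚ) : Tableau :=
  Function.update ξ k (Function.update (ξ k) j (ξ k j + δ))

/-- The `l`-coordinates: `l_{j,2p+1} = m_{j,2p+1} + p - j + 1` and `l_{j,2p} = m_{j,2p} + p - j`. -/
def lc (ξ : Tableau) (j k : ℕ) : ℚ :=
  if Even k then ξ k j + ((k / 2 : ℕ) : ℚ) - (j : ℚ)
  else ξ k j + ((k / 2 : ℕ) : ℚ) - (j : ℚ) + 1

/-- The expression under the square root in `A^j_{2p}(ξ)`. -/
noncomputable def radA (h : ℂ) (p j : ℕ) (ξ : Tableau) : ℂ :=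
  ((∏ i ∈ Finset.Icc 1 p,
      qnum h (lc ξ i (2 * p + 1) + lc ξ j (2 * p)) *
        qnum h (lc ξ i (2 * p + 1) - lc ξ j (2 * p) - 1)) *
    ∏ i ∈ Finset.Icc 1 (p - 1),
      qnum h (lc ξ i (2 * p - 1) + lc ξ j (2 * p)) *
        qnum h (lc ξ i (2 * p - 1) - lc ξ j (2 * p) - 1)) /
  ∏ i ∈ (Finset.Icc 1 p).erase j,
    qnum h (lc ξ i (2 * p) + lc ξ j (2 * p)) * qnum h (lc ξ i (2 * p) - lc ξ j (2 * p)) *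
      qnum h (lc ξ i (2 * p) + lc ξ j (2 * p) + 1) *
      qnum h (lc ξ i (2 * p) - lc ξ j (2 * p) - 1)

/-- The expression under the square root in `B^j_{2p-1}(ξ)`. -/
noncomputable def radB (h : ℂ) (p j : ℕ) (ξ : Tableau) : ℂ :=
  ((∏ i ∈ Finset.Icc 1 p,
      qnum h (lc ξ i (2 * p) + lc ξ j (2 * p - 1)) *
        qnum h (lc ξ i (2 * p) - lc ξ j (2 * p - 1))) *
    ∏ i ∈ Finset.Icc 1 (p - 1),
      qnum h (lc ξ i (2 * p - 2) + lc ξ j (2 * p - 1)) *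
        qnum h (lc ξ i (2 * p - 2) - lc ξ j (2 * p - 1))) /
  ∏ i ∈ (Finset.Icc 1 (p - 1)).erase j,
    qnum h (lc ξ i (2 * p - 1) + lc ξ j (2 * p - 1)) *
      qnum h (lc ξ i (2 * p - 1) - lc ξ j (2 * p - 1)) *
      qnum h (lc ξ i (2 * p - 1) + lc ξ j (2 * p - 1) - 1) *
      qnum h (lc ξ i (2 * p - 1) - lc ξ j (2 * p - 1) - 1)

/-- A choice of the square roots `A^j_{2p}(ξ)` and `B^j_{2p-1}(ξ)`. For positive `q` the
expressions that matter are positive and one takes positive roots; for complex `q` the formulas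
leave the branches open. -/
structure Roots (h : ℂ) where
  /-- `A p j ξ` is `A^j_{2p}(ξ)`. -/
  A : ℕ → ℕ → Tableau → ℂ
  /-- `B p j ξ` is `B^j_{2p-1}(ξ)`. -/
  B : ℕ → ℕ → Tableau → ℂ
  A_sq : ∀ p j ξ, A p j ξ ^ 2 = radA h p j ξ
  B_sq : ∀ p j ξ, B p j ξ ^ 2 = radB h p j ξ

/-- The principal square roots are a choice of roots. -/
noncomputable instance (h : ℂ) : Inhabited (Roots h) where
  default :=
    { A := fun p j ξ => radA h p j ξ ^ (((2 : ℕ) : ℂ)⁻¹)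
      B := fun p j ξ => radB h p j ξ ^ (((2 : ℕ) : ℂ)⁻¹)
      A_sq := fun _ _ _ => Complex.cpow_nat_inv_pow _ two_ne_zero
      B_sq := fun _ _ _ => Complex.cpow_nat_inv_pow _ two_ne_zero }

/-- The coefficient `C_{2p-1}(ξ)`. Where the denominator vanishes, an entry `l_{s,2p}` is `0`
as well, and the value of `C_{2p-1}` is understood to be `0`, as in Lean. -/
noncomputable def coeffC (h : ℂ) (p : ℕ) (ξ : Tableau) : ℂ :=
  ((∏ s ∈ Finset.Icc 1 p, qnum h (lc ξ s (2 * p))) *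
    ∏ s ∈ Finset.Icc 1 (p - 1), qnum h (lc ξ s (2 * p - 2))) /
  ∏ s ∈ Finset.Icc 1 (p - 1), qnum h (lc ξ s (2 * p - 1)) * qnum h (lc ξ s (2 * p - 1) - 1)

/-- The coefficient `Ĉ_{2p-1}(ξ)`. -/
noncomputable def coeffCHat (h : ℂ) (p : ℕ) (ξ : Tableau) : ℂ :=
  ((∏ s ∈ Finset.Icc 1 p, qnumPlus h (lc ξ s (2 * p))) *
    ∏ s ∈ Finset.Icc 1 (p - 1), qnumPlus h (lc ξ s (2 * p - 2))) /
  ∏ s ∈ Finset.Icc 1 (p - 1),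
    qnumPlus h (lc ξ s (2 * p - 1)) * qnumPlus h (lc ξ s (2 * p - 1) - 1)

/-- The coefficient `D_{2p}(ξ)`. -/
noncomputable def coeffD (h : ℂ) (p : ℕ) (ξ : Tableau) : ℂ :=
  ((∏ i ∈ Finset.Icc 1 p, qnum h (lc ξ i (2 * p + 1) - 1 / 2)) *
    ∏ i ∈ Finset.Icc 1 (p - 1), qnum h (lc ξ i (2 * p - 1) - 1 / 2)) /
  ∏ i ∈ Finset.Icc 1 (p - 1),
    qnum h (lc ξ i (2 * p) + 1 / 2) * qnum h (lc ξ i (2 * p) - 1 / 2)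

open Classical in
/-- The basis vector `|ξ⟩` of the space with basis the tableaux satisfying `P`; it is `0` if `ξ`
is not such a tableau. -/
noncomputable def ket (P : Tableau → Prop) (ξ : Tableau) : {ξ : Tableau // P ξ} →₀ ℂ :=
  if hξ : P ξ then Finsupp.single ⟨ξ, hξ⟩ 1 else 0

/-! ### Representations of the classical type -/

/-- The labels `m_n` of the representations of the classical type. -/
@[ext]
structure ClassicalLabel (n : ℕ) where
  /-- `m j` is `m_{j,n}`. -/
  m : ℕ → ℚ
  support : ∀ j, ¬ (1 ≤ j ∧ j ≤ n / 2) → m j = 0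
  integrality : (∀ j, 1 ≤ j → j ≤ n / 2 → ∃ z : ℤ, m j = z) ∨
    (∀ j, 1 ≤ j → j ≤ n / 2 → ∃ z : ℤ, m j = z + 1 / 2)
  dominance_odd : ∀ p, 1 ≤ p → n = 2 * p + 1 →
    (∀ j, 1 ≤ j → j < p → m (j + 1) ≤ m j) ∧ 0 ≤ m p
  dominance_even : ∀ p, 2 ≤ p → n = 2 * p →
    (∀ j, 1 ≤ j → j < p - 1 → m (j + 1) ≤ m j) ∧ |m p| ≤ m (p - 1)

/-- The Gel'fand--Tsetlin tableaux with top row `m_n`. All entries are integral if those of `m_n`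
are, and half-integral if those of `m_n` are. -/
structure IsClassicalTableau {n : ℕ} (M : ClassicalLabel n) (ξ : Tableau) : Prop where
  support : ∀ k j, ¬ (2 ≤ k ∧ k ≤ n ∧ 1 ≤ j ∧ j ≤ k / 2) → ξ k j = 0
  top : ∀ j, ξ n j = M.m j
  integrality : ∀ k j, 2 ≤ k → k ≤ n → 1 ≤ j → j ≤ k / 2 → ∃ z : ℤ, ξ k j = M.m 1 + z
  between_odd : ∀ p, 1 ≤ p → 2 * p + 1 ≤ n →
    (∀ j, 1 ≤ j → j ≤ p → ξ (2 * p) j ≤ ξ (2 * p + 1) j) ∧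
    (∀ j, 1 ≤ j → j < p → ξ (2 * p + 1) (j + 1) ≤ ξ (2 * p) j) ∧
    -ξ (2 * p + 1) p ≤ ξ (2 * p) p
  between_even : ∀ p, 2 ≤ p → 2 * p ≤ n →
    (∀ j, 1 ≤ j → j ≤ p - 1 → ξ (2 * p - 1) j ≤ ξ (2 * p) j) ∧
    (∀ j, 1 ≤ j → j < p - 1 → ξ (2 * p) (j + 1) ≤ ξ (2 * p - 1) j) ∧
    |ξ (2 * p) p| ≤ ξ (2 * p - 1) (p - 1)

/-- The space of the representation `T_{m_n}`. -/
abbrev ClassicalSpace {n : ℕ} (M : ClassicalLabel n) : Type :=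
  {ξ : Tableau // IsClassicalTableau M ξ} →₀ ℂ

/-- The vector `T_{m_n}(I_{2p+1,2p}) |ξ⟩`. -/
noncomputable def classicalOdd {h : ℂ} (R : Roots h) {n : ℕ} (M : ClassicalLabel n)
    (p : ℕ) (ξ : Tableau) : ClassicalSpace M :=
  (∑ j ∈ Finset.Icc 1 p,
    (R.A p j ξ / (qpow h (lc ξ j (2 * p)) + qpow h (-lc ξ j (2 * p)))) •
      ket (IsClassicalTableau M) (shift ξ (2 * p) j 1)) -
  ∑ j ∈ Finset.Icc 1 p,
    (R.A p j (shift ξ (2 * p) j (-1)) /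
        (qpow h (lc ξ j (2 * p)) + qpow h (-lc ξ j (2 * p)))) •
      ket (IsClassicalTableau M) (shift ξ (2 * p) j (-1))

/-- The vector `T_{m_n}(I_{2p,2p-1}) |ξ⟩`. -/
noncomputable def classicalEven {h : ℂ} (R : Roots h) {n : ℕ} (M : ClassicalLabel n)
    (p : ℕ) (ξ : Tableau) : ClassicalSpace M :=
  (∑ j ∈ Finset.Icc 1 (p - 1),
    (R.B p j ξ /
        (qnum h (2 * lc ξ j (2 * p - 1) - 1) * qnum h (lc ξ j (2 * p - 1)))) •
      ket (IsClassicalTableau M) (shift ξ (2 * p - 1) j 1)) -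
  (∑ j ∈ Finset.Icc 1 (p - 1),
    (R.B p j (shift ξ (2 * p - 1) j (-1)) /
        (qnum h (2 * lc ξ j (2 * p - 1) - 1) * qnum h (lc ξ j (2 * p - 1) - 1))) •
      ket (IsClassicalTableau M) (shift ξ (2 * p - 1) j (-1))) +
  (Complex.I * coeffC h p ξ) • ket (IsClassicalTableau M) ξ

/-- The representation `T_{m_n}` of the classical type: the operators `T_{m_n}(I_{k,k-1})`. -/
noncomputable def classicalRep {h : ℂ} (R : Roots h) {n : ℕ} (M : ClassicalLabel n)
    (k : Gen n) : Module.End ℂ (ClassicalSpace M) :=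
  Finsupp.linearCombination ℂ fun ξ : {ξ : Tableau // IsClassicalTableau M ξ} =>
    if Even (k : ℕ) then classicalEven R M ((k : ℕ) / 2) ξ
    else classicalOdd R M ((k : ℕ) / 2) ξ

/-! ### Representations of the nonclassical type -/

/-- The labels `(ε, m_n)` of the representations of the nonclassical type. -/
@[ext]
structure NonclassicalLabel (n : ℕ) where
  /-- The signs `ε_2, …, ε_n`. -/
  ε : Gen n → ℤˣ
  /-- `m j` is `m_{j,n}`. -/
  m : ℕ → ℚ
  support : ∀ j, ¬ (1 ≤ j ∧ j ≤ n / 2) → m j = 0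
  half_integral : ∀ j, 1 ≤ j → j ≤ n / 2 → ∃ z : ℤ, m j = z + 1 / 2
  antitone : ∀ j, 1 ≤ j → j < n / 2 → m (j + 1) ≤ m j
  half_le : 1 / 2 ≤ m (n / 2)

/-- The tableaux with top row `m_n` that label the basis of `T_{ε,m_n}`. -/
structure IsNonclassicalTableau {n : ℕ} (L : NonclassicalLabel n) (ξ : Tableau) : Prop where
  support : ∀ k j, ¬ (2 ≤ k ∧ k ≤ n ∧ 1 ≤ j ∧ j ≤ k / 2) → ξ k j = 0
  top : ∀ j, ξ n j = L.m j
  half_integral : ∀ k j, 2 ≤ k → k ≤ n → 1 ≤ j → j ≤ k / 2 → ∃ z : ℤ, ξ k j = z + 1 / 2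
  between_odd : ∀ p, 1 ≤ p → 2 * p + 1 ≤ n →
    (∀ j, 1 ≤ j → j ≤ p → ξ (2 * p) j ≤ ξ (2 * p + 1) j) ∧
    (∀ j, 1 ≤ j → j < p → ξ (2 * p + 1) (j + 1) ≤ ξ (2 * p) j) ∧
    1 / 2 ≤ ξ (2 * p) p
  between_even : ∀ p, 2 ≤ p → 2 * p ≤ n →
    (∀ j, 1 ≤ j → j ≤ p - 1 → ξ (2 * p - 1) j ≤ ξ (2 * p) j) ∧
    (∀ j, 1 ≤ j → j ≤ p - 1 → ξ (2 * p) (j + 1) ≤ ξ (2 * p - 1) j)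

/-- The space of the representation `T_{ε,m_n}`. -/
abbrev NonclassicalSpace {n : ℕ} (L : NonclassicalLabel n) : Type :=
  {ξ : Tableau // IsNonclassicalTableau L ξ} →₀ ℂ

/-- The vector `T_{ε,m_n}(I_{2p+1,2p}) |ξ⟩`, with `e = ε_{2p+1}`. If `m_{p,2p} = 1/2`, then
`(ξ)^{-p}_{2p}` is not a tableau, so the last sum is then effectively over `j < p`. -/
noncomputable def nonclassicalOdd {h : ℂ} (R : Roots h) {n : ℕ} (L : NonclassicalLabel n)
    (e : ℤˣ) (p : ℕ) (ξ : Tableau) : NonclassicalSpace L :=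
  ((if ξ (2 * p) p = 1 / 2 then 1 else 0) *
      (((e : ℤ) : ℂ) / (qpow h (1 / 2) - qpow h (-(1 / 2)))) * coeffD h p ξ) •
    ket (IsNonclassicalTableau L) ξ +
  (∑ j ∈ Finset.Icc 1 p,
    (R.A p j ξ / (qpow h (lc ξ j (2 * p)) - qpow h (-lc ξ j (2 * p)))) •
      ket (IsNonclassicalTableau L) (shift ξ (2 * p) j 1)) -
  ∑ j ∈ Finset.Icc 1 p,
    (R.A p j (shift ξ (2 * p) j (-1)) /
        (qpow h (lc ξ j (2 * p)) - qpow h (-lc ξ j (2 * p)))) •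
      ket (IsNonclassicalTableau L) (shift ξ (2 * p) j (-1))

/-- The vector `T_{ε,m_n}(I_{2p,2p-1}) |ξ⟩`, with `e = ε_{2p}`. -/
noncomputable def nonclassicalEven {h : ℂ} (R : Roots h) {n : ℕ} (L : NonclassicalLabel n)
    (e : ℤˣ) (p : ℕ) (ξ : Tableau) : NonclassicalSpace L :=
  (∑ j ∈ Finset.Icc 1 (p - 1),
    (R.B p j ξ /
        (qnum h (2 * lc ξ j (2 * p - 1) - 1) * qnumPlus h (lc ξ j (2 * p - 1)))) •
      ket (IsNonclassicalTableau L) (shift ξ (2 * p - 1) j 1)) -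
  (∑ j ∈ Finset.Icc 1 (p - 1),
    (R.B p j (shift ξ (2 * p - 1) j (-1)) /
        (qnum h (2 * lc ξ j (2 * p - 1) - 1) * qnumPlus h (lc ξ j (2 * p - 1) - 1))) •
      ket (IsNonclassicalTableau L) (shift ξ (2 * p - 1) j (-1))) +
  (((e : ℤ) : ℂ) * coeffCHat h p ξ) • ket (IsNonclassicalTableau L) ξ

/-- The representation `T_{ε,m_n}` of the nonclassical type: the operators
`T_{ε,m_n}(I_{k,k-1})`. -/
noncomputable def nonclassicalRep {h : ℂ} (R : Roots h) {n : ℕ} (L : NonclassicalLabel n)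
    (k : Gen n) : Module.End ℂ (NonclassicalSpace L) :=
  Finsupp.linearCombination ℂ fun ξ : {ξ : Tableau // IsNonclassicalTableau L ξ} =>
    if Even (k : ℕ) then nonclassicalEven R L (L.ε k) ((k : ℕ) / 2) ξ
    else nonclassicalOdd R L (L.ε k) ((k : ℕ) / 2) ξ

end QSO

/-!
# Irreducibility and inequivalence of the nonclassical representations of `U'_q(so_n)`

The argument is a separation argument in the style of Gel'fand and Tsetlin. For a finite family of
representations of the nonclassical type, consider the algebra of matrices generated by the
operators of `I_{21}, …, I_{K,K-1}` on the direct sum, and call two basis vectors indistinguishable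
if every diagonal matrix in this algebra has the same entry at both. Since diagonal matrices in the
algebra form an algebra of functions, the indicator function of every class of indistinguishable
basis vectors lies in it (`diagonal_classIndicator_mem`).

The key statement is that indistinguishable vectors have the same rows up to `K` and the same signs
`ε_2, …, ε_K` (`Indist.rows_eq_and_sign_eq`), by induction on `K`. For `K = 2` the operator of
`I_{21}` is diagonal with eigenvalues `ε_2 [m_{1,2}]₊`, which are different for different
`(ε_2, m_{1,2})` as `q` is not a root of unity. For the step from `K` to `K + 1`, let `N` be the
matrix of `I_{i+1,i}` with `i ≤ K`. It changes row `i` only, and row `i` is constant on the classes.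
So for the indicators `e`, `e'` of two classes the matrix `e N e' N e` is diagonal, and its entries
tell whether a given shift of an entry in row `i` leads to a tableau (`Indist.transport`,
`Indist.shift`); here one needs that the matrix entries between a tableau and its shifts do not
vanish (`nonclassicalRep_shift_ne_zero`). Therefore two indistinguishable tableaux can be shifted
simultaneously until row `K` of one of them attains all of its upper or all of its lower bounds.
These bounds are the entries of row `K + 1`, so the rows `K + 1` agree. The sign `ε_{K+1}` is
visible in the diagonal entries of `I_{K+1,K}`, which are nonzero at tableaux with minimal row `K`.

This reasoning involves only products of a matrix entry with the opposite one and diagonal entries,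
and no relations of the algebra, so that the choice of the square roots is irrelevant.

For `K = n` the projection to a basis vector thus comes from the algebra. Hence invariant subspaces
are spanned by basis vectors, and irreducibility follows since every tableau can be raised step by
step to the one that is constant along the columns. For different labels, a projection which is
nonzero in one representation vanishes in the other, so there is no injective intertwiner.
Representations of the classical type are excluded by the eigenvalues `i [m]` of `I_{21}`.
-/

namespace QSO

/-! ### Diagonal matrices in a matrix algebra -/

section Matrix

variable {X : Type*} [Fintype X] [DecidableEq X]

/-- Two indices are indistinguishable for a matrix algebra if no diagonal matrix in the algebra
has different entries there. -/
def Indist (𝒜 : Subalgebra ℂ (Matrix X X ℂ)) (x y : X) : Prop :=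
  ∀ f : X → ℂ, Matrix.diagonal f ∈ 𝒜 → f x = f y

variable {𝒜 ℬ : Subalgebra ℂ (Matrix X X ℂ)} {x y : X}

theorem Indist.refl (𝒜 : Subalgebra ℂ (Matrix X X ℂ)) (x : X) : Indist 𝒜 x x := fun _ _ => rfl

theorem Indist.symm (H : Indist 𝒜 x y) : Indist 𝒜 y x := fun f hf => (H f hf).symm

theorem Indist.mono (hle : 𝒜 ≤ ℬ) (H : Indist ℬ x y) : Indist 𝒜 x y := fun f hf => H f (hle hf)

open Classical in
/-- The indicator function of the indistinguishability class of `x`. -/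
noncomputable def classIndicator (𝒜 : Subalgebra ℂ (Matrix X X ℂ)) (x y : X) : ℂ :=
  if Indist 𝒜 x y then 1 else 0

theorem classIndicator_of_indist (H : Indist 𝒜 x y) : classIndicator 𝒜 x y = 1 := if_pos H

theorem indist_of_classIndicator_ne_zero (H : classIndicator 𝒜 x y ≠ 0) : Indist 𝒜 x y := by
  by_contra hn
  exact H (if_neg hn)

/-- Lagrange interpolation: finitely many points which are separated one by one are separated
by a single function. -/
theorem diagonal_classIndicator_mem (𝒜 : Subalgebra ℂ (Matrix X X ℂ)) (x : X) :
    Matrix.diagonal (classIndicator 𝒜 x) ∈ 𝒜 := by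
  have hD : ∀ f : X → ℂ, f ∈ 𝒜.comap (Matrix.diagonalAlgHom ℂ) ↔ Matrix.diagonal f ∈ 𝒜 :=
    fun f => Iff.rfl
  have key : ∀ y : X, ∃ g : X → ℂ, g ∈ 𝒜.comap (Matrix.diagonalAlgHom ℂ) ∧ g x = 1 ∧
      (¬ Indist 𝒜 x y → g y = 0) := by
    intro y
    by_cases hy : Indist 𝒜 x y
    · exact ⟨1, one_mem _, rfl, fun hn => absurd hy hn⟩
    · simp only [Indist, not_forall] at hy
      obtain ⟨f, hf, hne⟩ := hy
      have hne' : f x - f y ≠ 0 := sub_ne_zero.mpr hne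
      refine ⟨(f x - f y)⁻¹ • (f - algebraMap ℂ (X → ℂ) (f y)), ?_, ?_, ?_⟩
      · exact Subalgebra.smul_mem _ (sub_mem ((hD f).mpr hf) (Subalgebra.algebraMap_mem _ _)) _
      · simp [Pi.algebraMap_apply, inv_mul_cancel₀ hne']
      · simp [Pi.algebraMap_apply]
  choose g hg hg1 hg0 using key
  have hprod : (∏ y, g y) = classIndicator 𝒜 x := by
    funext z
    rw [Finset.prod_apply]
    by_cases hz : Indist 𝒜 x z
    · rw [classIndicator_of_indist hz]
      exact Finset.prod_eq_one fun y _ => by rw [← hz (g y) ((hD _).mp (hg y)), hg1]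
    · rw [classIndicator, if_neg hz]
      exact Finset.prod_eq_zero (Finset.mem_univ z) (hg0 z hz)
  rw [← hD, ← hprod]
  exact prod_mem fun y _ => hg y

variable {N : Matrix X X ℂ} {S C : Type*} {ρ : X → S} {c : X → C}

/-- A matrix of the algebra which changes only the coordinate `ρ`, where `ρ` is constant on the
classes, has the same diagonal entries at indistinguishable indices. -/
theorem Indist.diag_eq (hN : N ∈ 𝒜) (hρ : ∀ x y, Indist 𝒜 x y → ρ x = ρ y)
    (hc : ∀ x y, N x y ≠ 0 → c x = c y) (hinj : ∀ x y, ρ x = ρ y → c x = c y → x = y)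
    (H : Indist 𝒜 x y) : N x x = N y y := by
  set e := classIndicator 𝒜 x with he
  have hmem := mul_mem (mul_mem (diagonal_classIndicator_mem 𝒜 x) hN)
    (diagonal_classIndicator_mem 𝒜 x)
  have hdiag : Matrix.diagonal e * N * Matrix.diagonal e =
      Matrix.diagonal fun z => e z * N z z * e z := by
    ext z w
    rw [Matrix.mul_diagonal, Matrix.diagonal_mul]
    by_cases hzw : z = w
    · subst hzw; simp
    · rw [Matrix.diagonal_apply_ne _ hzw]
      by_contra hne
      have hz := indist_of_classIndicator_ne_zero (left_ne_zero_of_mul (left_ne_zero_of_mul hne))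
      have hw := indist_of_classIndicator_ne_zero (right_ne_zero_of_mul hne)
      exact hzw (hinj z w ((hρ _ _ hz).symm.trans (hρ _ _ hw))
        (hc _ _ (right_ne_zero_of_mul (left_ne_zero_of_mul hne))))
  rw [hdiag] at hmem
  have := H _ hmem
  simpa [he, classIndicator_of_indist H, classIndicator_of_indist (Indist.refl 𝒜 x)] using this

/-- If a matrix `N` of the algebra connects `x` with `x'` in both directions and changes only a
coordinate `ρ` which is constant on the classes, then it connects every `y` indistinguishable
from `x` with some `y'` indistinguishable from `x'`. With `e`, `e'` the indicators of the classes
of `x`, `x'`, the matrix `e N e' N e` is diagonal and its entry at `x` does not vanish. -/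
theorem Indist.transport (hN : N ∈ 𝒜) (hρ : ∀ x y, Indist 𝒜 x y → ρ x = ρ y)
    (hc : ∀ x y, N x y ≠ 0 → c x = c y) (hinj : ∀ x y, ρ x = ρ y → c x = c y → x = y)
    (H : Indist 𝒜 x y) {x' : X} (h₁ : N x' x ≠ 0) (h₂ : N x x' ≠ 0) :
    ∃ y', Indist 𝒜 x' y' ∧ N y' y ≠ 0 := by
  set e := classIndicator 𝒜 x with he
  set e' := classIndicator 𝒜 x' with he'
  have hmem := mul_mem (mul_mem (mul_mem (diagonal_classIndicator_mem 𝒜 x) hN)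
    (diagonal_classIndicator_mem 𝒜 x')) (mul_mem hN (diagonal_classIndicator_mem 𝒜 x))
  rw [← he, ← he'] at hmem
  have hdiag : Matrix.diagonal e * N * Matrix.diagonal e' * (N * Matrix.diagonal e) =
      Matrix.diagonal fun z => ∑ v, e z * N z v * e' v * (N v z * e z) := by
    ext z w
    rw [Matrix.mul_apply]
    simp only [Matrix.mul_diagonal, Matrix.diagonal_mul]
    by_cases hzw : z = w
    · subst hzw; rw [Matrix.diagonal_apply_eq]
    · rw [Matrix.diagonal_apply_ne _ hzw]
      refine Finset.sum_eq_zero fun v _ => ?_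
      by_contra hne
      have hl := left_ne_zero_of_mul (left_ne_zero_of_mul hne)
      have hr := right_ne_zero_of_mul hne
      have hz := indist_of_classIndicator_ne_zero (left_ne_zero_of_mul hl)
      have hw := indist_of_classIndicator_ne_zero (right_ne_zero_of_mul hr)
      exact hzw (hinj z w ((hρ _ _ hz).symm.trans (hρ _ _ hw))
        ((hc _ _ (right_ne_zero_of_mul hl)).trans (hc _ _ (left_ne_zero_of_mul hr))))
  rw [hdiag] at hmem
  have hxy := H _ hmem
  have hx : ∑ v, e x * N x v * e' v * (N v x * e x) = N x x' * N x' x := by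
    rw [Finset.sum_eq_single x']
    · simp [he, he', classIndicator_of_indist (Indist.refl 𝒜 _)]
    · intro v _ hv
      by_contra hne
      have hv' := indist_of_classIndicator_ne_zero (right_ne_zero_of_mul (left_ne_zero_of_mul hne))
      have hcv := hc _ _ (left_ne_zero_of_mul (right_ne_zero_of_mul hne))
      exact hv (hinj _ _ (hρ _ _ hv').symm (hcv.trans (hc _ _ h₁).symm))
    · exact fun hn => absurd (Finset.mem_univ _) hn
  have hy : ∑ v, e y * N y v * e' v * (N v y * e y) ≠ 0 := by
    rw [← hxy, hx]
    exact mul_ne_zero h₂ h₁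
  obtain ⟨v, -, hv⟩ := Finset.exists_ne_zero_of_sum_ne_zero hy
  exact ⟨v, indist_of_classIndicator_ne_zero (right_ne_zero_of_mul (left_ne_zero_of_mul hv)),
    left_ne_zero_of_mul (right_ne_zero_of_mul hv)⟩

end Matrix

/-! ### Powers of `q` and `q`-numbers -/

section QNumbers

variable {h : ℂ}

theorem qpow_zero (h : ℂ) : qpow h 0 = 1 := by simp [qpow]

theorem qpow_add (h : ℂ) (a b : ℚ) : qpow h (a + b) = qpow h a * qpow h b := by
  rw [qpow, qpow, qpow, ← Complex.exp_add]
  push_cast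
  ring_nf

theorem qpow_mul_neg (h : ℂ) (a : ℚ) : qpow h a * qpow h (-a) = 1 := by
  rw [← qpow_add, add_neg_cancel, qpow_zero]

theorem qpow_ne_one (hq : ∀ N : ℕ, 0 < N → Complex.exp h ^ N ≠ 1) {a : ℚ} (ha : a ≠ 0) :
    qpow h a ≠ 1 := by
  intro H
  have hd : (a.den : ℂ) ≠ 0 := Nat.cast_ne_zero.mpr a.den_nz
  have hnum : h * (a.num : ℂ) = a.den * (h * (a : ℂ)) := by
    have : (a : ℂ) = a.num / a.den := Rat.cast_def a
    rw [this]
    field_simp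
  have hz : Complex.exp h ^ a.num = 1 := by
    rw [← Complex.exp_int_mul, mul_comm, hnum, Complex.exp_nat_mul]
    exact (congrArg (· ^ a.den) H).trans (one_pow _)
  have hN : Complex.exp h ^ a.num.natAbs = 1 := by
    rcases Int.natAbs_eq a.num with h' | h'
    · rw [h', zpow_natCast] at hz
      exact hz
    · rw [h', zpow_neg, zpow_natCast, inv_eq_one] at hz
      exact hz
  exact hq _ (Int.natAbs_pos.mpr (Rat.num_ne_zero.mpr ha)) hN

theorem qpow_ne_neg_one (hq : ∀ N : ℕ, 0 < N → Complex.exp h ^ N ≠ 1) (a : ℚ) :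
    qpow h a ≠ -1 := by
  intro H
  have H2 : qpow h (a + a) = 1 := by rw [qpow_add, H]; norm_num
  by_cases ha : a = 0
  · rw [ha, qpow_zero] at H
    norm_num at H
  · exact qpow_ne_one hq (a := a + a) (by intro h0; exact ha (by linarith)) H2

theorem qpow_sub_ne_zero (hq : ∀ N : ℕ, 0 < N → Complex.exp h ^ N ≠ 1) {a : ℚ} (ha : a ≠ 0) :
    qpow h a - qpow h (-a) ≠ 0 := by
  intro H
  refine qpow_ne_one hq (a := a + a) (by intro h0; exact ha (by linarith)) ?_
  rw [qpow_add]
  linear_combination qpow h a * H + qpow_mul_neg h a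

theorem qpow_add_ne_zero (hq : ∀ N : ℕ, 0 < N → Complex.exp h ^ N ≠ 1) (a : ℚ) :
    qpow h a + qpow h (-a) ≠ 0 := by
  intro H
  refine qpow_ne_neg_one hq (a + a) ?_
  rw [qpow_add]
  linear_combination qpow h a * H - qpow_mul_neg h a

theorem qnum_ne_zero (hq : ∀ N : ℕ, 0 < N → Complex.exp h ^ N ≠ 1) {a : ℚ} (ha : a ≠ 0) :
    qnum h a ≠ 0 :=
  div_ne_zero (qpow_sub_ne_zero hq ha) (qpow_sub_ne_zero hq one_ne_zero)

theorem qnumPlus_ne_zero (hq : ∀ N : ℕ, 0 < N → Complex.exp h ^ N ≠ 1) (a : ℚ) :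
    qnumPlus h a ≠ 0 :=
  div_ne_zero (qpow_add_ne_zero hq a) (qpow_sub_ne_zero hq one_ne_zero)

theorem unit_sq (e : ℤˣ) : ((e : ℤ) : ℂ) ^ 2 = 1 := by
  rcases Int.units_eq_one_or e with rfl | rfl <;> norm_num

/-- The eigenvalues `ε [a]₊` of `I_{21}` determine `ε` and `a`. -/
theorem unit_mul_qnumPlus_inj (hq : ∀ N : ℕ, 0 < N → Complex.exp h ^ N ≠ 1) {e e' : ℤˣ}
    {a b : ℚ} (ha : 0 < a) (hb : 0 < b)
    (H : ((e : ℤ) : ℂ) * qnumPlus h a = ((e' : ℤ) : ℂ) * qnumPlus h b) : e = e' ∧ a = b := by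
  have hab : a = b := by
    by_contra hne
    have h0 := qpow_sub_ne_zero hq one_ne_zero
    have H' : ((e : ℤ) : ℂ) * (qpow h a + qpow h (-a)) =
        ((e' : ℤ) : ℂ) * (qpow h b + qpow h (-b)) := by
      simp only [qnumPlus] at H
      field_simp at H
      exact H
    have hsq : (qpow h a + qpow h (-a)) ^ 2 = (qpow h b + qpow h (-b)) ^ 2 := by
      have := congrArg (· ^ 2) H'
      simpa only [mul_pow, unit_sq, one_mul] using this
    -- The difference of the two sides is a product of two factors of the form `q ^ c - q ^ (-c)`.
    have hfac : (qpow h (a + b) - qpow h (-(a + b))) * (qpow h (a - b) - qpow h (-(a - b))) = 0 := by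
      rw [show -(a + b) = -a + -b by ring, show -(a - b) = -a + b by ring, sub_eq_add_neg a b]
      simp only [qpow_add]
      have ea := qpow_mul_neg h a
      have eb := qpow_mul_neg h b
      linear_combination hsq + (qpow h b * qpow h b * (-1) - qpow h (-b) * qpow h (-b) - 2) * ea +
        (qpow h a * qpow h a + qpow h (-a) * qpow h (-a) + 2) * eb
    rcases mul_eq_zero.mp hfac with h1 | h1
    · exact qpow_sub_ne_zero hq (by positivity) h1
    · exact qpow_sub_ne_zero hq (sub_ne_zero.mpr hne) h1
  subst hab
  have := mul_right_cancel₀ (qnumPlus_ne_zero hq a) H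
  exact ⟨Units.ext (by exact_mod_cast this), rfl⟩

/-- The eigenvalues `ε [a]₊` and `i [b]` of `I_{21}` in representations of the two types never
coincide. -/
theorem unit_mul_qnumPlus_ne (hq : ∀ N : ℕ, 0 < N → Complex.exp h ^ N ≠ 1) (e : ℤˣ) (a b : ℚ) :
    ((e : ℤ) : ℂ) * qnumPlus h a ≠ Complex.I * qnum h b := by
  intro H
  have h0 := qpow_sub_ne_zero hq one_ne_zero
  have H' : ((e : ℤ) : ℂ) * (qpow h a + qpow h (-a)) =
      Complex.I * (qpow h b - qpow h (-b)) := by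
    simp only [qnumPlus, qnum] at H
    field_simp at H
    exact H
  have hsq : (qpow h a + qpow h (-a)) ^ 2 = -(qpow h b - qpow h (-b)) ^ 2 := by
    have := congrArg (· ^ 2) H'
    simpa only [mul_pow, unit_sq, one_mul, Complex.I_sq, neg_mul] using this
  have hfac : (qpow h (a + b) + qpow h (-(a + b))) * (qpow h (a - b) + qpow h (-(a - b))) = 0 := by
    rw [show -(a + b) = -a + -b by ring, show -(a - b) = -a + b by ring, sub_eq_add_neg a b]
    simp only [qpow_add]
    have ea := qpow_mul_neg h a
    have eb := qpow_mul_neg h b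
    linear_combination hsq + (qpow h b * qpow h b + qpow h (-b) * qpow h (-b) - 2) * ea +
      (qpow h a * qpow h a + qpow h (-a) * qpow h (-a) + 2) * eb
  rcases mul_eq_zero.mp hfac with h1 | h1
  · exact qpow_add_ne_zero hq _ h1
  · exact qpow_add_ne_zero hq _ h1

end QNumbers

/-! ### Gel'fand--Tsetlin tableaux of the nonclassical type -/

section Tableaux

theorem shift_apply (ξ : Tableau) (i j : ℕ) (δ : ℚ) (k l : ℕ) :
    shift ξ i j δ k l = if k = i ∧ l = j then ξ i j + δ else ξ k l := by
  unfold shift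
  by_cases hk : k = i
  · subst hk
    by_cases hl : l = j
    · subst hl; simp
    · simp [hl]
  · simp [hk]

theorem shift_apply_self (ξ : Tableau) (i j : ℕ) (δ : ℚ) : shift ξ i j δ i j = ξ i j + δ := by
  simp [shift_apply]

theorem shift_row_of_ne (ξ : Tableau) {i k : ℕ} (j : ℕ) (δ : ℚ) (hk : k ≠ i) :
    shift ξ i j δ k = ξ k := by
  simp [shift, hk]

theorem shift_row_congr {ξ η : Tableau} {i : ℕ} (hi : ξ i = η i) (j : ℕ) (δ : ℚ) :
    shift ξ i j δ i = shift η i j δ i := by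
  simp [shift, hi]

theorem shift_shift_neg (ξ : Tableau) (i j : ℕ) (δ : ℚ) :
    shift (shift ξ i j δ) i j (-δ) = ξ := by
  funext k l
  rw [shift_apply, shift_apply_self]
  split_ifs with hkl
  · rw [hkl.1, hkl.2]; ring
  · rw [shift_apply, if_neg hkl]

theorem lt_shift (ξ : Tableau) (i j : ℕ) {δ : ℚ} (hδ : 0 < δ) : ξ < shift ξ i j δ := by
  refine lt_of_le_of_ne (fun k l => ?_) fun H => ?_
  · rw [shift_apply]
    split_ifs with hkl
    · rw [hkl.1, hkl.2]; linarith
    · exact le_rfl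
  · have := congrFun (congrFun H i) j
    rw [shift_apply_self] at this
    linarith

theorem shift_lt (ξ : Tableau) (i j : ℕ) {δ : ℚ} (hδ : δ < 0) : shift ξ i j δ < ξ := by
  have := lt_shift (shift ξ i j δ) i j (neg_pos.mpr hδ)
  rwa [shift_shift_neg] at this

/-- Two shifts of the same tableau by nonzero amounts coincide only trivially. -/
theorem shift_eq_shift_iff {ξ : Tableau} {i j j' : ℕ} {δ δ' : ℚ} (hδ : δ ≠ 0) :
    shift ξ i j δ = shift ξ i j' δ' ↔ j = j' ∧ δ = δ' := by
  refine ⟨fun H => ?_, fun H => by rw [H.1, H.2]⟩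
  have H1 := congrFun (congrFun H i) j
  rw [shift_apply_self, shift_apply] at H1
  split_ifs at H1 with hj
  · obtain ⟨-, rfl⟩ := hj
    exact ⟨rfl, by linarith⟩
  · exact absurd (by linarith) hδ

theorem shift_ne_self {ξ : Tableau} {i j : ℕ} {δ : ℚ} (hδ : δ ≠ 0) : shift ξ i j δ ≠ ξ := by
  intro H
  have H1 := congrFun (congrFun H i) j
  rw [shift_apply_self] at H1
  exact hδ (by linarith)

theorem add_one_le_of_half_integral {a b : ℚ} (ha : ∃ z : ℤ, a = z + 1 / 2)
    (hb : ∃ z : ℤ, b = z + 1 / 2) (hab : a < b) : a + 1 ≤ b := by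
  obtain ⟨z, rfl⟩ := ha
  obtain ⟨w, rfl⟩ := hb
  have h1 : (z : ℚ) < w := by linarith
  have h2 : z + 1 ≤ w := by exact_mod_cast h1
  have h3 : (z : ℚ) + 1 ≤ w := by exact_mod_cast h2
  linarith

variable {n : ℕ} {L : NonclassicalLabel n} {ξ : Tableau}

namespace IsNonclassicalTableau

theorem le_succ_row (hξ : IsNonclassicalTableau L ξ) {k j : ℕ} (hk : 2 ≤ k) (hkn : k < n)
    (hj : 1 ≤ j) (hjk : j ≤ k / 2) : ξ k j ≤ ξ (k + 1) j := by
  obtain ⟨p, rfl | rfl⟩ := Nat.even_or_odd' k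
  · exact (hξ.between_odd p (by omega) (by omega)).1 j hj (by omega)
  · exact (hξ.between_even (p + 1) (by omega) (by omega)).1 j hj (by omega)

theorem succ_row_le (hξ : IsNonclassicalTableau L ξ) {k j : ℕ} (hk : 2 ≤ k) (hkn : k < n)
    (hj : 1 ≤ j) (hjk : j + 1 ≤ (k + 1) / 2) : ξ (k + 1) (j + 1) ≤ ξ k j := by
  obtain ⟨p, rfl | rfl⟩ := Nat.even_or_odd' k
  · exact (hξ.between_odd p (by omega) (by omega)).2.1 j hj (by omega)
  · exact (hξ.between_even (p + 1) (by omega) (by omega)).2 j hj (by omega)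

theorem le_row_of_le (hξ : IsNonclassicalTableau L ξ) {k j : ℕ} (hk : 2 ≤ k) (hj : 1 ≤ j)
    (hjk : j ≤ k / 2) (d : ℕ) (hd : k + d ≤ n) : ξ k j ≤ ξ (k + d) j := by
  induction d with
  | zero => exact le_rfl
  | succ d ih =>
    exact (ih (by omega)).trans (hξ.le_succ_row (by omega) (by omega) hj (by omega))

theorem half_le (hξ : IsNonclassicalTableau L ξ) {k j : ℕ} (hkn : k ≤ n)
    (hj : 1 ≤ j) (hjk : j ≤ k / 2) : 1 / 2 ≤ ξ k j := by
  have hle := hξ.le_row_of_le (k := 2 * j) (by omega) hj (by omega) (k - 2 * j) (by omega)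
  rw [show 2 * j + (k - 2 * j) = k by omega] at hle
  refine le_trans ?_ hle
  rcases Nat.lt_or_ge (2 * j) n with h | h
  · exact (hξ.between_odd j hj h).2.2
  · have h2 : n = 2 * j := by omega
    have := L.half_le
    rwa [show n / 2 = j by omega, ← hξ.top j, h2] at this

theorem le_top (hξ : IsNonclassicalTableau L ξ) {k j : ℕ} (hk : 2 ≤ k) (hkn : k ≤ n)
    (hj : 1 ≤ j) (hjk : j ≤ k / 2) : ξ k j ≤ L.m j := by
  have hle := hξ.le_row_of_le hk hj hjk (n - k) (by omega)
  rwa [show k + (n - k) = n by omega, hξ.top] at hle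

/-- The interlacing conditions, stated in the same way for odd and even rows. -/
theorem of_interlacing
    (support : ∀ k j, ¬ (2 ≤ k ∧ k ≤ n ∧ 1 ≤ j ∧ j ≤ k / 2) → ξ k j = 0)
    (top : ∀ j, ξ n j = L.m j)
    (half_integral : ∀ k j, 2 ≤ k → k ≤ n → 1 ≤ j → j ≤ k / 2 → ∃ z : ℤ, ξ k j = z + 1 / 2)
    (le_succ : ∀ k j, 2 ≤ k → k < n → 1 ≤ j → j ≤ k / 2 → ξ k j ≤ ξ (k + 1) j)
    (succ_le : ∀ k j, 2 ≤ k → k < n → 1 ≤ j → j + 1 ≤ (k + 1) / 2 → ξ (k + 1) (j + 1) ≤ ξ k j)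
    (half_le : ∀ k j, 2 ≤ k → k < n → 1 ≤ j → j ≤ k / 2 → 1 / 2 ≤ ξ k j) :
    IsNonclassicalTableau L ξ where
  support := support
  top := top
  half_integral := half_integral
  between_odd p hp hpn :=
    ⟨fun j hj hjp => le_succ _ j (by omega) (by omega) hj (by omega),
      fun j hj hjp => succ_le _ j (by omega) (by omega) hj (by omega),
      half_le _ p (by omega) (by omega) hp (by omega)⟩
  between_even p hp hpn := by
    obtain ⟨k, hk⟩ : ∃ k, 2 * p = k + 1 := ⟨2 * p - 1, by omega⟩
    rw [hk, Nat.add_sub_cancel]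
    exact ⟨fun j hj hjp => le_succ _ j (by omega) (by omega) hj (by omega),
      fun j hj hjp => succ_le _ j (by omega) (by omega) hj (by omega)⟩

theorem antitone_row (hξ : IsNonclassicalTableau L ξ) {k i j : ℕ} (hk : 2 ≤ k) (hkn : k ≤ n)
    (hi : 1 ≤ i) (hij : i ≤ j) (hjk : j ≤ k / 2) : ξ k j ≤ ξ k i := by
  induction j, hij using Nat.le_induction with
  | base => exact le_rfl
  | succ j hij ih =>
    refine le_trans ?_ (ih (by omega))
    obtain ⟨k, rfl⟩ : ∃ k', k = k' + 1 := ⟨k - 1, by omega⟩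
    exact (hξ.succ_row_le (by omega) (by omega) (by omega) hjk).trans
      (hξ.le_succ_row (by omega) (by omega) (by omega) (by omega))

/-- The shifted array is a tableau as soon as the new entry interlaces with its neighbours. -/
theorem shift_of_bounds (hξ : IsNonclassicalTableau L ξ) {i j : ℕ} (hi : 2 ≤ i) (hin : i < n)
    (hj : 1 ≤ j) (hji : j ≤ i / 2) (δ : ℤ) (hU : ξ i j + δ ≤ ξ (i + 1) j)
    (hL : j + 1 ≤ (i + 1) / 2 → ξ (i + 1) (j + 1) ≤ ξ i j + δ)
    (hD : j ≤ (i - 1) / 2 → ξ (i - 1) j ≤ ξ i j + δ)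
    (hR : 2 ≤ j → ξ i j + δ ≤ ξ (i - 1) (j - 1)) (hh : 1 / 2 ≤ ξ i j + δ) :
    IsNonclassicalTableau L (shift ξ i j δ) := by
  refine of_interlacing ?_ ?_ ?_ ?_ ?_ ?_
  · intro k l hkl
    rw [shift_apply, if_neg (fun h => hkl (by omega))]
    exact hξ.support k l hkl
  · intro l
    rw [shift_row_of_ne _ _ _ (by omega)]
    exact hξ.top l
  · intro k l hk hkn hl hlk
    rw [shift_apply]
    split_ifs
    · obtain ⟨z, hz⟩ := hξ.half_integral i j hi hin.le hj hji
      exact ⟨z + δ, by rw [hz]; push_cast; ring⟩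
    · exact hξ.half_integral k l hk hkn hl hlk
  · intro k l hk hkn hl hlk
    rw [shift_apply, shift_apply]
    split_ifs with h1 h2 h2
    · omega
    · rw [h1.1, h1.2]; exact hU
    · obtain ⟨rfl, rfl⟩ := h2
      exact hD (by simpa using hlk)
    · exact hξ.le_succ_row hk hkn hl hlk
  · intro k l hk hkn hl hlk
    rw [shift_apply, shift_apply]
    split_ifs with h1 h2 h2
    · omega
    · obtain ⟨rfl, rfl⟩ := h1
      exact hR (by omega)
    · obtain ⟨rfl, rfl⟩ := h2
      exact hL (by omega)
    · exact hξ.succ_row_le hk hkn hl hlk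
  · intro k l hk hkn hl hlk
    rw [shift_apply]
    split_ifs
    · exact hh
    · exact hξ.half_le hkn.le hl hlk

/-- A tableau none of whose entries in the rows up to `K` can be raised is constant along the
columns up to row `K + 1`. -/
theorem eq_succ_row_of_forall_not_shift (hξ : IsNonclassicalTableau L ξ) {K : ℕ} (hK : K < n)
    (H : ∀ i j, 2 ≤ i → i ≤ K → 1 ≤ j → j ≤ i / 2 → ¬ IsNonclassicalTableau L (shift ξ i j 1))
    (i : ℕ) (hi : 2 ≤ i) (hiK : i ≤ K) : ∀ j, 1 ≤ j → j ≤ i / 2 → ξ i j = ξ (i + 1) j := by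
  induction i, hi using Nat.le_induction with
  | base =>
    intro j hj hji
    by_contra hne
    have hlt := lt_of_le_of_ne (hξ.le_succ_row le_rfl (by omega) hj hji) hne
    have h1 := add_one_le_of_half_integral (hξ.half_integral _ _ le_rfl (by omega) hj hji)
      (hξ.half_integral _ _ (by omega) (by omega) hj (by omega)) hlt
    have hh := hξ.half_le (by omega) hj hji
    refine H 2 j le_rfl hiK hj hji ?_
    exact_mod_cast hξ.shift_of_bounds le_rfl (by omega) hj hji 1 (by exact_mod_cast h1)
      (by omega) (by omega) (by omega) (by push_cast; linarith)
  | succ i hi ih =>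
    intro j hj hji
    by_contra hne
    have hlt := lt_of_le_of_ne (hξ.le_succ_row (by omega) (by omega) hj hji) hne
    have h1 := add_one_le_of_half_integral
      (hξ.half_integral _ _ (by omega) (by omega) hj hji)
      (hξ.half_integral _ _ (by omega) (by omega) hj (by omega)) hlt
    have hh := hξ.half_le (by omega) hj hji
    refine H (i + 1) j (by omega) hiK hj hji ?_
    refine mod_cast hξ.shift_of_bounds (by omega) (by omega) hj hji 1 (by exact_mod_cast h1)
      ?_ ?_ ?_ (by push_cast; linarith)
    · intro hj2
      have := hξ.succ_row_le (k := i + 1) (by omega) (by omega) hj hj2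
      push_cast; linarith
    · intro hj2
      rw [Nat.add_sub_cancel] at hj2 ⊢
      have := hξ.le_succ_row hi (by omega) hj hj2
      push_cast; linarith
    · -- The left neighbour in the row below is already as large as its upper bound.
      intro hj2
      obtain ⟨j, rfl⟩ : ∃ j', j = j' + 1 := ⟨j - 1, by omega⟩
      rw [Nat.add_sub_cancel, Nat.add_sub_cancel, ih (by omega) j (by omega) (by omega)]
      have := hξ.succ_row_le (k := i + 1) (j := j) (by omega) (by omega) (by omega) (by omega)
      push_cast; linarith

/-- In a tableau none of whose entries in the rows up to `K` can be lowered, these entries are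
equal to their lower bounds. -/
theorem eq_lower_bound_of_forall_not_shift (hξ : IsNonclassicalTableau L ξ) {K : ℕ} (hK : K < n)
    (H : ∀ i j, 2 ≤ i → i ≤ K → 1 ≤ j → j ≤ i / 2 →
      ¬ IsNonclassicalTableau L (shift ξ i j (-1)))
    (i : ℕ) (hi : 2 ≤ i) (hiK : i ≤ K) : ∀ j, 1 ≤ j → j ≤ i / 2 →
      ξ i j = if j + 1 ≤ (i + 1) / 2 then ξ (i + 1) (j + 1) else 1 / 2 := by
  have key : ∀ i, 2 ≤ i → i ≤ K → ∀ j, 1 ≤ j → j ≤ i / 2 →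
      (j ≤ (i - 1) / 2 → ξ (i - 1) j = if j + 1 ≤ i / 2 then ξ i (j + 1) else 1 / 2) →
      ξ i j = if j + 1 ≤ (i + 1) / 2 then ξ (i + 1) (j + 1) else 1 / 2 := by
    intro i hi hiK j hj hji hprev
    set b : ℚ := if j + 1 ≤ (i + 1) / 2 then ξ (i + 1) (j + 1) else 1 / 2 with hb
    have hble : b ≤ ξ i j := by
      rw [hb]
      split_ifs with h
      · exact hξ.succ_row_le hi (by omega) hj h
      · exact hξ.half_le (by omega) hj hji
    have hbh : ∃ z : ℤ, b = z + 1 / 2 := by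
      rw [hb]
      split_ifs with h
      · exact hξ.half_integral _ _ (by omega) (by omega) (by omega) h
      · exact ⟨0, by norm_num⟩
    have hb2 : 1 / 2 ≤ b := by
      rw [hb]
      split_ifs with h
      · exact hξ.half_le (by omega) (by omega) h
      · exact le_rfl
    by_contra hne
    have h1 := add_one_le_of_half_integral hbh (hξ.half_integral _ _ hi (by omega) hj hji)
      (lt_of_le_of_ne hble (Ne.symm hne))
    refine H i j hi hiK hj hji ?_
    refine mod_cast hξ.shift_of_bounds hi (by omega) hj hji (-1) ?_ ?_ ?_ ?_
      (by push_cast; linarith)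
    · have := hξ.le_succ_row hi (by omega) hj hji
      push_cast; linarith
    · intro hj2
      rw [hb, if_pos hj2] at h1
      push_cast; linarith
    · intro hj2
      rw [hprev hj2]
      split_ifs with h
      · have := hξ.le_succ_row (k := i) (j := j + 1) hi (by omega) (by omega) (by omega)
        rw [hb, if_pos (by omega)] at h1
        push_cast; linarith
      · push_cast; linarith
    · intro hj2
      obtain ⟨j, rfl⟩ : ∃ j', j = j' + 1 := ⟨j - 1, by omega⟩
      obtain ⟨i, rfl⟩ : ∃ i', i = i' + 1 := ⟨i - 1, by omega⟩
      have := hξ.succ_row_le (k := i) (j := j) (by omega) (by omega) (by omega) hji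
      rw [Nat.add_sub_cancel, Nat.add_sub_cancel]
      push_cast; linarith
  induction i, hi using Nat.le_induction with
  | base => exact fun j hj hji => key 2 le_rfl hiK j hj hji (by omega)
  | succ i hi ih =>
    intro j hj hji
    refine key (i + 1) (by omega) hiK j hj hji fun hj2 => ?_
    rw [Nat.add_sub_cancel] at hj2 ⊢
    exact ih (by omega) j hj hj2

end IsNonclassicalTableau

instance finite_nonclassicalTableaux (L : NonclassicalLabel n) :
    Finite {ξ : Tableau // IsNonclassicalTableau L ξ} := by
  obtain ⟨B, hB⟩ : ∃ B : ℕ, ∀ j ∈ Finset.range (n + 1), L.m j ≤ B := by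
    obtain ⟨B, hB⟩ := exists_nat_ge (∑ j ∈ Finset.range (n + 1), |L.m j|)
    exact ⟨B, fun j hj => (le_abs_self _).trans
      ((Finset.single_le_sum (f := fun j => |L.m j|) (fun _ _ => abs_nonneg _) hj).trans hB)⟩
  let S : Set ℚ := insert 0 ((fun z : ℕ => (z : ℚ) + 1 / 2) '' Set.Iic B)
  have hS : S.Finite := (Set.Finite.image _ (Set.finite_Iic B)).insert 0
  have : Finite S := hS
  have hmem : ∀ ξ : {ξ : Tableau // IsNonclassicalTableau L ξ}, ∀ k j, ξ.1 k j ∈ S := by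
    rintro ⟨ξ, hξ⟩ k j
    by_cases hkj : 2 ≤ k ∧ k ≤ n ∧ 1 ≤ j ∧ j ≤ k / 2
    · obtain ⟨hk, hkn, hj, hjk⟩ := hkj
      obtain ⟨z, hz⟩ := hξ.half_integral k j hk hkn hj hjk
      have h1 := hξ.half_le hkn hj hjk
      have h2 := (hξ.le_top hk hkn hj hjk).trans (hB j (Finset.mem_range.mpr (by omega)))
      have hz0 : 0 ≤ z := by
        have : (0 : ℚ) ≤ z := by linarith
        exact_mod_cast this
      lift z to ℕ using hz0
      refine Or.inr ⟨z, ?_, by simpa using hz.symm⟩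
      have : (z : ℚ) ≤ B := by rw [hz] at h2; push_cast at h2; linarith
      exact_mod_cast this
    · exact Or.inl (hξ.support k j hkj)
  refine Finite.of_injective
    (fun ξ : {ξ : Tableau // IsNonclassicalTableau L ξ} =>
      fun kj : Fin (n + 1) × Fin (n + 1) => (⟨ξ.1 kj.1 kj.2, hmem ξ _ _⟩ : S)) ?_
  intro ξ η H
  refine Subtype.ext (funext fun k => funext fun j => ?_)
  by_cases hkj : 2 ≤ k ∧ k ≤ n ∧ 1 ≤ j ∧ j ≤ k / 2
  · exact congrArg Subtype.val
      (congrFun H (⟨k, by omega⟩, ⟨j, by omega⟩))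
  · rw [ξ.2.support k j hkj, η.2.support k j hkj]

theorem NonclassicalLabel.m_antitone (L : NonclassicalLabel n) {i j : ℕ} (hi : 1 ≤ i)
    (hij : i ≤ j) (hj : j ≤ n / 2) : L.m j ≤ L.m i := by
  induction j, hij using Nat.le_induction with
  | base => exact le_rfl
  | succ j hij ih => exact (L.antitone j (by omega) (by omega)).trans (ih (by omega))

/-- The tableau which is constant along the columns. -/
theorem nonempty_nonclassicalTableaux (hn : 2 ≤ n) (L : NonclassicalLabel n) :
    Nonempty {ξ : Tableau // IsNonclassicalTableau L ξ} := by
  refine ⟨fun k j => if 2 ≤ k ∧ k ≤ n ∧ 1 ≤ j ∧ j ≤ k / 2 then L.m j else 0, ?_⟩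
  refine IsNonclassicalTableau.of_interlacing ?_ ?_ ?_ ?_ ?_ ?_
  · intro k j hkj
    exact if_neg hkj
  · intro j
    by_cases hj : 1 ≤ j ∧ j ≤ n / 2
    · exact if_pos (by omega)
    · exact (if_neg (by omega)).trans (L.support j hj).symm
  · intro k j hk hkn hj hjk
    rw [if_pos (by omega)]
    exact L.half_integral j hj (by omega)
  · intro k j hk hkn hj hjk
    rw [if_pos (by omega), if_pos (by omega)]
  · intro k j hk hkn hj hjk
    rw [if_pos (by omega), if_pos (by omega)]
    exact L.antitone j hj (by omega)
  · intro k j hk hkn hj hjk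
    rw [if_pos (by omega)]
    exact L.half_le.trans (L.m_antitone hj (by omega) le_rfl)

end Tableaux

/-! ### Matrix entries of the generators -/

section Coefficients

theorem lc_two_mul (ξ : Tableau) (j p : ℕ) : lc ξ j (2 * p) = ξ (2 * p) j + p - j := by
  rw [lc, if_pos (by simp)]
  simp

theorem lc_two_mul_add_one (ξ : Tableau) (j p : ℕ) :
    lc ξ j (2 * p + 1) = ξ (2 * p + 1) j + p - j + 1 := by
  rw [lc, if_neg (by simp), show (2 * p + 1) / 2 = p by omega]

theorem lc_congr {ξ η : Tableau} {k : ℕ} (H : ξ k = η k) (j : ℕ) : lc ξ j k = lc η j k := by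
  rw [lc, lc, H]

variable {n : ℕ} {L : NonclassicalLabel n} {ξ : Tableau} {h : ℂ}

/-- If the entry `m_{j,k}` of a tableau can be raised, then all factors in numerator and
denominator of the square of `A^j_{2p}` or `B^j_{2p-1}` are nonzero. This is derived from the following
inequalities between `m_{j,k}` and the entries of the rows `k - 1`, `k` and `k + 1`. -/
theorem IsNonclassicalTableau.raise_bounds (hξ : IsNonclassicalTableau L ξ) {k j : ℕ}
    (hk : 2 ≤ k) (hkn : k < n) (hj : 1 ≤ j) (hjk : j ≤ k / 2)
    (hs : IsNonclassicalTableau L (shift ξ k j 1)) :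
    (∀ i, 1 ≤ i → i ≤ j → ξ k j + 1 ≤ ξ (k + 1) i) ∧
    (∀ i, j < i → i ≤ (k + 1) / 2 → ξ (k + 1) i ≤ ξ k j) ∧
    (∀ i, 1 ≤ i → i < j → ξ k j + 1 ≤ ξ (k - 1) i) ∧
    (∀ i, j ≤ i → i ≤ (k - 1) / 2 → ξ (k - 1) i ≤ ξ k j) ∧
    (∀ i, 1 ≤ i → i < j → ξ k j + 1 ≤ ξ k i) ∧
    (∀ i, j < i → i ≤ k / 2 → ξ k i ≤ ξ k j) := by
  refine ⟨fun i hi hij => ?_, fun i hij hik => ?_, fun i hi hij => ?_, fun i hij hik => ?_,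
    fun i hi hij => ?_, fun i hij hik => ?_⟩
  · have h1 := hs.le_succ_row hk hkn hj hjk
    rw [shift_apply_self, shift_row_of_ne _ _ _ (by omega)] at h1
    exact h1.trans (hξ.antitone_row (by omega) (by omega) hi hij (by omega))
  · exact (hξ.antitone_row (by omega) (by omega) (by omega) (show j + 1 ≤ i from hij) hik).trans
      (hξ.succ_row_le hk hkn hj (by omega))
  · obtain ⟨k, rfl⟩ : ∃ k', k = k' + 1 := ⟨k - 1, by omega⟩
    obtain ⟨j, rfl⟩ : ∃ j', j = j' + 1 := ⟨j - 1, by omega⟩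
    have h1 := hs.succ_row_le (k := k) (j := j) (by omega) (by omega) (by omega) hjk
    rw [shift_apply_self, shift_row_of_ne _ _ _ (by omega)] at h1
    rw [Nat.add_sub_cancel]
    exact h1.trans (hξ.antitone_row (by omega) (by omega) hi (by omega) (by omega))
  · obtain ⟨k, rfl⟩ : ∃ k', k = k' + 1 := ⟨k - 1, by omega⟩
    rw [Nat.add_sub_cancel] at hik ⊢
    exact (hξ.antitone_row (by omega) (by omega) hj hij hik).trans
      (hξ.le_succ_row (by omega) (by omega) hj (by omega))
  · have h1 := hs.antitone_row (by omega) (by omega) hi hij.le hjk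
    rwa [shift_apply_self, shift_apply, if_neg (by omega)] at h1
  · exact hξ.antitone_row (by omega) (by omega) hj hij.le hik

theorem radA_ne_zero (hq : ∀ N : ℕ, 0 < N → Complex.exp h ^ N ≠ 1)
    (hξ : IsNonclassicalTableau L ξ) {p j : ℕ} (hpn : 2 * p < n) (hj : 1 ≤ j)
    (hjp : j ≤ p) (hs : IsNonclassicalTableau L (shift ξ (2 * p) j 1)) : radA h p j ξ ≠ 0 := by
  obtain ⟨ha1, ha2, hb1, hb2, hc1, hc2⟩ :=
    hξ.raise_bounds (by omega) hpn hj (by omega) hs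
  have hx := hξ.half_le (k := 2 * p) (by omega) hj (by omega)
  have hjp' : (j : ℚ) ≤ p := by exact_mod_cast hjp
  refine div_ne_zero (mul_ne_zero ?_ ?_) ?_ <;> refine Finset.prod_ne_zero_iff.mpr fun i hi => ?_
  · obtain ⟨hi1, hip⟩ := Finset.mem_Icc.mp hi
    have hy := hξ.half_le (k := 2 * p + 1) (j := i) (by omega) hi1 (by omega)
    have hip' : (i : ℚ) ≤ p := by exact_mod_cast hip
    rw [lc_two_mul, lc_two_mul_add_one]
    refine mul_ne_zero (qnum_ne_zero hq ?_) (qnum_ne_zero hq ?_)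
    · exact ne_of_gt (by linarith)
    · rcases Nat.lt_or_ge j i with hji | hij
      · have h1 := ha2 i hji (by omega)
        have : (j : ℚ) + 1 ≤ i := by exact_mod_cast hji
        exact ne_of_lt (by linarith)
      · have h1 := ha1 i hi1 hij
        have : (i : ℚ) ≤ j := by exact_mod_cast hij
        exact ne_of_gt (by linarith)
  · obtain ⟨hi1, hip⟩ := Finset.mem_Icc.mp hi
    obtain ⟨r, rfl⟩ : ∃ r, p = r + 1 := ⟨p - 1, by omega⟩
    rw [show 2 * (r + 1) - 1 = 2 * r + 1 by omega] at hb1 hb2 ⊢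
    have hy := hξ.half_le (k := 2 * r + 1) (j := i) (by omega) hi1 (by omega)
    have hip' : (i : ℚ) ≤ r := by exact_mod_cast hip
    push_cast at hjp'
    rw [lc_two_mul, lc_two_mul_add_one]
    push_cast
    refine mul_ne_zero (qnum_ne_zero hq ?_) (qnum_ne_zero hq ?_)
    · exact ne_of_gt (by linarith)
    · rcases Nat.lt_or_ge i j with hij | hji
      · have h1 := hb1 i hi1 hij
        have : (i : ℚ) + 1 ≤ j := by exact_mod_cast hij
        exact ne_of_gt (by linarith)
      · have h1 := hb2 i hji (by omega)
        have : (j : ℚ) ≤ i := by exact_mod_cast hji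
        exact ne_of_lt (by linarith)
  · obtain ⟨hij, hi⟩ := Finset.mem_erase.mp hi
    obtain ⟨hi1, hip⟩ := Finset.mem_Icc.mp hi
    have hy := hξ.half_le (k := 2 * p) (j := i) (by omega) hi1 (by omega)
    have hip' : (i : ℚ) ≤ p := by exact_mod_cast hip
    rw [lc_two_mul, lc_two_mul]
    rcases Nat.lt_or_gt_of_ne hij with hij | hji
    · have h1 := hc1 i hi1 hij
      have : (i : ℚ) + 1 ≤ j := by exact_mod_cast hij
      refine mul_ne_zero (mul_ne_zero (mul_ne_zero ?_ ?_) ?_) ?_ <;>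
        exact qnum_ne_zero hq (ne_of_gt (by linarith))
    · have h1 := hc2 i hji (by omega)
      have : (j : ℚ) + 1 ≤ i := by exact_mod_cast hji
      refine mul_ne_zero (mul_ne_zero (mul_ne_zero ?_ ?_) ?_) ?_
      · exact qnum_ne_zero hq (ne_of_gt (by linarith))
      · exact qnum_ne_zero hq (ne_of_lt (by linarith))
      · exact qnum_ne_zero hq (ne_of_gt (by linarith))
      · exact qnum_ne_zero hq (ne_of_lt (by linarith))

theorem radB_ne_zero (hq : ∀ N : ℕ, 0 < N → Complex.exp h ^ N ≠ 1)
    (hξ : IsNonclassicalTableau L ξ) {p j : ℕ} (hpn : 2 * p - 1 < n) (hj : 1 ≤ j)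
    (hjp : j ≤ p - 1) (hs : IsNonclassicalTableau L (shift ξ (2 * p - 1) j 1)) :
    radB h p j ξ ≠ 0 := by
  obtain ⟨r, rfl⟩ : ∃ r, p = r + 1 := ⟨p - 1, by omega⟩
  rw [Nat.add_sub_cancel] at hjp
  rw [show 2 * (r + 1) - 1 = 2 * r + 1 by omega] at hs hpn
  obtain ⟨ha1, ha2, hb1, hb2, hc1, hc2⟩ :=
    hξ.raise_bounds (by omega) hpn hj (by omega) hs
  rw [show 2 * r + 1 + 1 = 2 * (r + 1) by ring] at ha1 ha2
  rw [Nat.add_sub_cancel] at hb1 hb2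
  have hx := hξ.half_le (k := 2 * r + 1) (by omega) hj (by omega)
  have hjp' : (j : ℚ) ≤ r := by exact_mod_cast hjp
  rw [radB, Nat.add_sub_cancel, show 2 * (r + 1) - 1 = 2 * r + 1 by omega,
    show 2 * (r + 1) - 2 = 2 * r by omega]
  refine div_ne_zero (mul_ne_zero ?_ ?_) ?_ <;> refine Finset.prod_ne_zero_iff.mpr fun i hi => ?_
  · obtain ⟨hi1, hip⟩ := Finset.mem_Icc.mp hi
    have hy := hξ.half_le (k := 2 * (r + 1)) (j := i) (by omega) hi1 (by omega)
    have hip' : (i : ℚ) ≤ r + 1 := by exact_mod_cast hip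
    rw [lc_two_mul, lc_two_mul_add_one]
    push_cast
    refine mul_ne_zero (qnum_ne_zero hq ?_) (qnum_ne_zero hq ?_)
    · exact ne_of_gt (by linarith)
    · rcases Nat.lt_or_ge j i with hji | hij
      · have h1 := ha2 i hji (by omega)
        have : (j : ℚ) + 1 ≤ i := by exact_mod_cast hji
        exact ne_of_lt (by linarith)
      · have h1 := ha1 i hi1 hij
        have : (i : ℚ) ≤ j := by exact_mod_cast hij
        exact ne_of_gt (by linarith)
  · obtain ⟨hi1, hip⟩ := Finset.mem_Icc.mp hi
    have hy := hξ.half_le (k := 2 * r) (j := i) (by omega) hi1 (by omega)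
    have hip' : (i : ℚ) ≤ r := by exact_mod_cast hip
    rw [lc_two_mul, lc_two_mul_add_one]
    refine mul_ne_zero (qnum_ne_zero hq ?_) (qnum_ne_zero hq ?_)
    · exact ne_of_gt (by linarith)
    · rcases Nat.lt_or_ge i j with hij | hji
      · have h1 := hb1 i hi1 hij
        have : (i : ℚ) + 1 ≤ j := by exact_mod_cast hij
        exact ne_of_gt (by linarith)
      · have h1 := hb2 i hji (by omega)
        have : (j : ℚ) ≤ i := by exact_mod_cast hji
        exact ne_of_lt (by linarith)
  · obtain ⟨hij, hi⟩ := Finset.mem_erase.mp hi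
    obtain ⟨hi1, hip⟩ := Finset.mem_Icc.mp hi
    have hy := hξ.half_le (k := 2 * r + 1) (j := i) (by omega) hi1 (by omega)
    have hip' : (i : ℚ) ≤ r := by exact_mod_cast hip
    rw [lc_two_mul_add_one, lc_two_mul_add_one]
    rcases Nat.lt_or_gt_of_ne hij with hij | hji
    · have h1 := hc1 i hi1 hij
      have : (i : ℚ) + 1 ≤ j := by exact_mod_cast hij
      refine mul_ne_zero (mul_ne_zero (mul_ne_zero ?_ ?_) ?_) ?_ <;>
        exact qnum_ne_zero hq (ne_of_gt (by linarith))
    · have h1 := hc2 i hji (by omega)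
      have : (j : ℚ) + 1 ≤ i := by exact_mod_cast hji
      refine mul_ne_zero (mul_ne_zero (mul_ne_zero ?_ ?_) ?_) ?_
      · exact qnum_ne_zero hq (ne_of_gt (by linarith))
      · exact qnum_ne_zero hq (ne_of_lt (by linarith))
      · exact qnum_ne_zero hq (ne_of_gt (by linarith))
      · exact qnum_ne_zero hq (ne_of_lt (by linarith))

theorem coeffCHat_ne_zero (hq : ∀ N : ℕ, 0 < N → Complex.exp h ^ N ≠ 1) (p : ℕ) (ξ : Tableau) :
    coeffCHat h p ξ ≠ 0 := by
  refine div_ne_zero (mul_ne_zero ?_ ?_) ?_ <;> refine Finset.prod_ne_zero_iff.mpr fun i _ => ?_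
  · exact qnumPlus_ne_zero hq _
  · exact qnumPlus_ne_zero hq _
  · exact mul_ne_zero (qnumPlus_ne_zero hq _) (qnumPlus_ne_zero hq _)

theorem coeffD_ne_zero (hq : ∀ N : ℕ, 0 < N → Complex.exp h ^ N ≠ 1)
    (hξ : IsNonclassicalTableau L ξ) {p : ℕ} (hp : 1 ≤ p) (hpn : 2 * p < n) :
    coeffD h p ξ ≠ 0 := by
  refine div_ne_zero (mul_ne_zero ?_ ?_) ?_ <;> refine Finset.prod_ne_zero_iff.mpr fun i hi => ?_
  · obtain ⟨hi1, hip⟩ := Finset.mem_Icc.mp hi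
    have hy := hξ.half_le (k := 2 * p + 1) (j := i) (by omega) hi1 (by omega)
    have hip' : (i : ℚ) ≤ p := by exact_mod_cast hip
    rw [lc_two_mul_add_one]
    exact qnum_ne_zero hq (ne_of_gt (by linarith))
  · obtain ⟨hi1, hip⟩ := Finset.mem_Icc.mp hi
    obtain ⟨r, rfl⟩ : ∃ r, p = r + 1 := ⟨p - 1, by omega⟩
    rw [show 2 * (r + 1) - 1 = 2 * r + 1 by omega]
    have hy := hξ.half_le (k := 2 * r + 1) (j := i) (by omega) hi1 (by omega)
    have hip' : (i : ℚ) ≤ r := by exact_mod_cast hip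
    rw [lc_two_mul_add_one]
    exact qnum_ne_zero hq (ne_of_gt (by linarith))
  · obtain ⟨hi1, hip⟩ := Finset.mem_Icc.mp hi
    have hy := hξ.half_le (k := 2 * p) (j := i) (by omega) hi1 (by omega)
    have hip' : (i : ℚ) + 1 ≤ p := by exact_mod_cast (show i + 1 ≤ p by omega)
    rw [lc_two_mul]
    exact mul_ne_zero (qnum_ne_zero hq (ne_of_gt (by linarith)))
      (qnum_ne_zero hq (ne_of_gt (by linarith)))

theorem coeffCHat_congr {ξ η : Tableau} {p : ℕ} (H : ∀ k ≤ 2 * p, ξ k = η k) :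
    coeffCHat h p ξ = coeffCHat h p η := by
  simp only [coeffCHat, lc_congr (H (2 * p) le_rfl), lc_congr (H (2 * p - 1) (by omega)),
    lc_congr (H (2 * p - 2) (by omega))]

theorem coeffD_congr {ξ η : Tableau} {p : ℕ} (H : ∀ k ≤ 2 * p + 1, ξ k = η k) :
    coeffD h p ξ = coeffD h p η := by
  simp only [coeffD, lc_congr (H (2 * p + 1) le_rfl), lc_congr (H (2 * p) (by omega)),
    lc_congr (H (2 * p - 1) (by omega))]

/-- The coefficient of `|ξ⟩` in `T(I_{k,k-1}) |ξ⟩`, divided by `ε_k`. -/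
noncomputable def diagCoeff (h : ℂ) (k : ℕ) (ξ : Tableau) : ℂ :=
  if Even k then coeffCHat h (k / 2) ξ
  else (if ξ (2 * (k / 2)) (k / 2) = 1 / 2 then 1 else 0) *
    (1 / (qpow h (1 / 2) - qpow h (-(1 / 2)))) * coeffD h (k / 2) ξ

/-- The coefficient of `|ξ^{+j}_{k-1}⟩` in `T(I_{k,k-1}) |ξ⟩`. -/
noncomputable def raiseCoeff (R : Roots h) (k j : ℕ) (ξ : Tableau) : ℂ :=
  if Even k then R.B (k / 2) j ξ /
    (qnum h (2 * lc ξ j (k - 1) - 1) * qnumPlus h (lc ξ j (k - 1)))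
  else R.A (k / 2) j ξ / (qpow h (lc ξ j (k - 1)) - qpow h (-lc ξ j (k - 1)))

/-- The negative of the coefficient of `|ξ^{-j}_{k-1}⟩` in `T(I_{k,k-1}) |ξ⟩`. -/
noncomputable def lowerCoeff (R : Roots h) (k j : ℕ) (ξ : Tableau) : ℂ :=
  if Even k then R.B (k / 2) j (shift ξ (k - 1) j (-1)) /
    (qnum h (2 * lc ξ j (k - 1) - 1) * qnumPlus h (lc ξ j (k - 1) - 1))
  else R.A (k / 2) j (shift ξ (k - 1) j (-1)) /
    (qpow h (lc ξ j (k - 1)) - qpow h (-lc ξ j (k - 1)))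

open Classical in
theorem ket_apply (P : Tableau → Prop) (ξ : Tableau) (η : {ξ : Tableau // P ξ}) :
    ket P ξ η = if ξ = η.1 then 1 else 0 := by
  unfold ket
  split_ifs with h1 h2 h2
  · subst h2; simp
  · exact Finsupp.single_eq_of_ne fun h => h2 (congrArg Subtype.val h).symm
  · exact absurd (h2 ▸ η.2) h1
  · rfl

theorem nonclassicalRep_single (R : Roots h) (L : NonclassicalLabel n) (k : Gen n)
    (ξ : {ξ : Tableau // IsNonclassicalTableau L ξ}) :
    nonclassicalRep R L k (Finsupp.single ξ 1) =
      (((L.ε k : ℤ) : ℂ) * diagCoeff h k ξ) • ket (IsNonclassicalTableau L) ξ +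
      (∑ j ∈ Finset.Icc 1 (((k : ℕ) - 1) / 2),
        raiseCoeff R k j ξ • ket (IsNonclassicalTableau L) (shift ξ (k - 1) j 1)) -
      ∑ j ∈ Finset.Icc 1 (((k : ℕ) - 1) / 2),
        lowerCoeff R k j ξ • ket (IsNonclassicalTableau L) (shift ξ (k - 1) j (-1)) := by
  have hk := k.2.1
  rw [nonclassicalRep, Finsupp.linearCombination_single, one_smul]
  by_cases he : Even (k : ℕ)
  · simp only [if_pos he, diagCoeff, raiseCoeff, lowerCoeff, nonclassicalEven]
    obtain ⟨p, hp⟩ := he.two_dvd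
    rw [hp, show 2 * p / 2 = p by omega, show (2 * p - 1) / 2 = p - 1 by omega]
    abel
  · simp only [if_neg he, diagCoeff, raiseCoeff, lowerCoeff, nonclassicalOdd]
    obtain ⟨p, hp⟩ := Nat.not_even_iff_odd.mp he
    rw [hp, show (2 * p + 1) / 2 = p by omega, Nat.add_sub_cancel, show 2 * p / 2 = p by omega]
    congr 3
    ring

/-- A nonzero matrix entry of `T(I_{k,k-1})` connects tableaux that differ in row `k - 1`
only. -/
theorem row_eq_of_nonclassicalRep_ne_zero {R : Roots h} {k : Gen n}
    {ξ η : {ξ : Tableau // IsNonclassicalTableau L ξ}}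
    (H : nonclassicalRep R L k (Finsupp.single ξ 1) η ≠ 0) {i : ℕ} (hi : i ≠ (k : ℕ) - 1) :
    η.1 i = ξ.1 i := by
  classical
  by_contra hne
  refine H ?_
  rw [nonclassicalRep_single]
  simp only [Finsupp.coe_sub, Finsupp.coe_add, Finsupp.coe_smul, Finsupp.coe_finsetSum,
    Pi.sub_apply, Pi.add_apply, Pi.smul_apply, Finset.sum_apply, ket_apply]
  rw [if_neg (fun h => hne (by rw [← h])), Finset.sum_eq_zero, Finset.sum_eq_zero]
  · simp
  all_goals
    intro j _
    rw [if_neg (fun h => hne (by rw [← h, shift_row_of_ne _ _ _ hi])), smul_zero]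

theorem nonclassicalRep_apply_self (R : Roots h) (k : Gen n)
    (ξ : {ξ : Tableau // IsNonclassicalTableau L ξ}) :
    nonclassicalRep R L k (Finsupp.single ξ 1) ξ = ((L.ε k : ℤ) : ℂ) * diagCoeff h k ξ := by
  classical
  rw [nonclassicalRep_single]
  simp only [Finsupp.coe_sub, Finsupp.coe_add, Finsupp.coe_smul, Finsupp.coe_finsetSum,
    Pi.sub_apply, Pi.add_apply, Pi.smul_apply, Finset.sum_apply, ket_apply]
  rw [if_pos trivial, Finset.sum_eq_zero, Finset.sum_eq_zero]
  · simp
  all_goals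
    intro j _
    rw [if_neg (shift_ne_self (by norm_num)), smul_zero]

theorem nonclassicalRep_apply_raise (R : Roots h) (k : Gen n) {j : ℕ} (hj : 1 ≤ j)
    (hjk : j ≤ ((k : ℕ) - 1) / 2) (ξ η : {ξ : Tableau // IsNonclassicalTableau L ξ})
    (hη : η.1 = shift ξ ((k : ℕ) - 1) j 1) :
    nonclassicalRep R L k (Finsupp.single ξ 1) η = raiseCoeff R k j ξ := by
  classical
  rw [nonclassicalRep_single]
  simp only [Finsupp.coe_sub, Finsupp.coe_add, Finsupp.coe_smul, Finsupp.coe_finsetSum,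
    Pi.sub_apply, Pi.add_apply, Pi.smul_apply, Finset.sum_apply, ket_apply, hη]
  rw [if_neg (shift_ne_self (by norm_num)).symm,
    Finset.sum_eq_single_of_mem j (Finset.mem_Icc.mpr ⟨hj, hjk⟩), Finset.sum_eq_zero]
  · simp
  · intro i _
    rw [if_neg, smul_zero]
    rw [shift_eq_shift_iff (by norm_num)]
    norm_num
  · intro i _ hi
    rw [if_neg, smul_zero]
    rw [shift_eq_shift_iff (by norm_num)]
    exact fun h => hi h.1

theorem nonclassicalRep_apply_lower (R : Roots h) (k : Gen n) {j : ℕ} (hj : 1 ≤ j)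
    (hjk : j ≤ ((k : ℕ) - 1) / 2) (ξ η : {ξ : Tableau // IsNonclassicalTableau L ξ})
    (hη : η.1 = shift ξ ((k : ℕ) - 1) j (-1)) :
    nonclassicalRep R L k (Finsupp.single ξ 1) η = -lowerCoeff R k j ξ := by
  classical
  rw [nonclassicalRep_single]
  simp only [Finsupp.coe_sub, Finsupp.coe_add, Finsupp.coe_smul, Finsupp.coe_finsetSum,
    Pi.sub_apply, Pi.add_apply, Pi.smul_apply, Finset.sum_apply, ket_apply, hη]
  rw [if_neg (shift_ne_self (by norm_num)).symm, Finset.sum_eq_zero,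
    Finset.sum_eq_single_of_mem j (Finset.mem_Icc.mpr ⟨hj, hjk⟩)]
  · simp
  · intro i _ hi
    rw [if_neg, smul_zero]
    rw [shift_eq_shift_iff (by norm_num)]
    exact fun h => hi h.1
  · intro i _
    rw [if_neg, smul_zero]
    rw [shift_eq_shift_iff (by norm_num)]
    norm_num

/-- The coordinates `l = l_{j,k}` of a tableau are positive, and so is `2 l - 1` in odd rows. Hence
the denominators `q ^ l - q ^ (-l)` and `[2 l - 1]` of the matrix entries do not vanish. -/
theorem IsNonclassicalTableau.lc_pos (hξ : IsNonclassicalTableau L ξ) {k j : ℕ}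
    (hkn : k ≤ n) (hj : 1 ≤ j) (hjk : j ≤ k / 2) :
    0 < lc ξ j k ∧ (¬ Even k → 0 < 2 * lc ξ j k - 1) := by
  have hx := hξ.half_le hkn hj hjk
  have hjk' : (j : ℚ) ≤ (k / 2 : ℕ) := by exact_mod_cast hjk
  unfold lc
  split_ifs with he
  · exact ⟨by linarith, fun h => absurd he h⟩
  · exact ⟨by linarith, fun _ => by linarith⟩

theorem raiseCoeff_ne_zero (hq : ∀ N : ℕ, 0 < N → Complex.exp h ^ N ≠ 1) (R : Roots h)
    (hξ : IsNonclassicalTableau L ξ) {k j : ℕ} (hkn : k ≤ n) (hj : 1 ≤ j)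
    (hjk : j ≤ (k - 1) / 2) (hs : IsNonclassicalTableau L (shift ξ (k - 1) j 1)) :
    raiseCoeff R k j ξ ≠ 0 := by
  obtain ⟨hl, hl'⟩ := hξ.lc_pos (k := k - 1) (by omega) hj hjk
  unfold raiseCoeff
  split_ifs with he
  · obtain ⟨p, rfl⟩ := he.two_dvd
    refine div_ne_zero ?_ (mul_ne_zero (qnum_ne_zero hq (hl' ?_).ne') (qnumPlus_ne_zero hq _))
    · rw [show 2 * p / 2 = p by omega, ← pow_ne_zero_iff two_ne_zero, R.B_sq]
      exact radB_ne_zero hq hξ (by omega) hj (by omega) hs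
    · rw [Nat.not_even_iff_odd, Nat.odd_iff]
      omega
  · obtain ⟨p, rfl⟩ := Nat.not_even_iff_odd.mp he
    refine div_ne_zero ?_ (qpow_sub_ne_zero hq hl.ne')
    rw [show (2 * p + 1) / 2 = p by omega, ← pow_ne_zero_iff two_ne_zero, R.A_sq]
    exact radA_ne_zero hq hξ (by omega) hj (by omega) hs

theorem lowerCoeff_ne_zero (hq : ∀ N : ℕ, 0 < N → Complex.exp h ^ N ≠ 1) (R : Roots h)
    (hξ : IsNonclassicalTableau L ξ) {k j : ℕ} (hkn : k ≤ n) (hj : 1 ≤ j)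
    (hjk : j ≤ (k - 1) / 2) (hs : IsNonclassicalTableau L (shift ξ (k - 1) j (-1))) :
    lowerCoeff R k j ξ ≠ 0 := by
  obtain ⟨hl, hl'⟩ := hξ.lc_pos (k := k - 1) (by omega) hj hjk
  have hback : IsNonclassicalTableau L (shift (shift ξ (k - 1) j (-1)) (k - 1) j 1) := by
    have := shift_shift_neg ξ (k - 1) j (-1)
    rw [neg_neg] at this
    rwa [this]
  unfold lowerCoeff
  split_ifs with he
  · obtain ⟨p, rfl⟩ := he.two_dvd
    refine div_ne_zero ?_ (mul_ne_zero (qnum_ne_zero hq (hl' ?_).ne') (qnumPlus_ne_zero hq _))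
    · rw [show 2 * p / 2 = p by omega, ← pow_ne_zero_iff two_ne_zero, R.B_sq]
      exact radB_ne_zero hq hs (by omega) hj (by omega) hback
    · rw [Nat.not_even_iff_odd, Nat.odd_iff]
      omega
  · obtain ⟨p, rfl⟩ := Nat.not_even_iff_odd.mp he
    refine div_ne_zero ?_ (qpow_sub_ne_zero hq hl.ne')
    rw [show (2 * p + 1) / 2 = p by omega, ← pow_ne_zero_iff two_ne_zero, R.A_sq]
    exact radA_ne_zero hq hs (by omega) hj (by omega) hback

/-- The operator `T(I_{k,k-1})` connects `|ξ⟩` with `|ξ^{±j}_{k-1}⟩` in both directions. -/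
theorem nonclassicalRep_shift_ne_zero (hq : ∀ N : ℕ, 0 < N → Complex.exp h ^ N ≠ 1)
    (R : Roots h) (k : Gen n) {j : ℕ} (hj : 1 ≤ j) (hjk : j ≤ ((k : ℕ) - 1) / 2) {δ : ℚ}
    (hδ : δ = 1 ∨ δ = -1) (ξ η : {ξ : Tableau // IsNonclassicalTableau L ξ})
    (hη : η.1 = shift ξ ((k : ℕ) - 1) j δ) :
    nonclassicalRep R L k (Finsupp.single ξ 1) η ≠ 0 ∧
      nonclassicalRep R L k (Finsupp.single η 1) ξ ≠ 0 := by
  have hback : ξ.1 = shift η ((k : ℕ) - 1) j (-δ) := by rw [hη, shift_shift_neg]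
  rcases hδ with rfl | rfl
  · rw [nonclassicalRep_apply_raise R k hj hjk ξ η hη,
      nonclassicalRep_apply_lower R k hj hjk η ξ hback, neg_ne_zero]
    exact ⟨raiseCoeff_ne_zero hq R ξ.2 k.2.2 hj hjk (hη ▸ η.2),
      lowerCoeff_ne_zero hq R η.2 k.2.2 hj hjk (hback ▸ ξ.2)⟩
  · rw [neg_neg] at hback
    rw [nonclassicalRep_apply_lower R k hj hjk ξ η hη,
      nonclassicalRep_apply_raise R k hj hjk η ξ hback, neg_ne_zero]
    exact ⟨lowerCoeff_ne_zero hq R ξ.2 k.2.2 hj hjk (hη ▸ η.2),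
      raiseCoeff_ne_zero hq R η.2 k.2.2 hj hjk (hback ▸ ξ.2)⟩

end Coefficients

/-! ### Separation of tableaux by the subalgebras generated by the first generators -/

section Separation

noncomputable instance {n : ℕ} (L : NonclassicalLabel n) :
    Fintype {ξ : Tableau // IsNonclassicalTableau L ξ} := Fintype.ofFinite _

noncomputable instance {n : ℕ} (L : NonclassicalLabel n) :
    DecidableEq {ξ : Tableau // IsNonclassicalTableau L ξ} := Classical.decEq _

variable {β : Type} {n : ℕ} {h : ℂ}

/-- The indices of the bases of a family of representations of the nonclassical type. -/
abbrev State (L : β → NonclassicalLabel n) : Type :=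
  Σ b, {ξ : Tableau // IsNonclassicalTableau (L b) ξ}

variable {R : β → Roots h} {L : β → NonclassicalLabel n}

theorem State.ext {x y : State L} (hb : x.1 = y.1) (hξ : x.2.1 = y.2.1) : x = y := by
  obtain ⟨b, ξ⟩ := x
  obtain ⟨b', η⟩ := y
  obtain rfl : b = b' := hb
  rw [show ξ = η from Subtype.ext hξ]

/-- The part of a basis index which is left unchanged by `I_{i+1,i}`: everything but row `i`. -/
def State.erase (i : ℕ) (x : State L) : β × Tableau := (x.1, Function.update x.2.1 i 0)

theorem State.erase_eq_iff {i : ℕ} {x y : State L} :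
    x.erase i = y.erase i ↔ x.1 = y.1 ∧ ∀ k, k ≠ i → x.2.1 k = y.2.1 k := by
  rw [State.erase, State.erase, Prod.mk.injEq]
  refine and_congr_right fun _ => ⟨fun H k hk => ?_, fun H => funext fun k => ?_⟩
  · simpa [hk] using congrFun H k
  · by_cases hk : k = i
    · subst hk; simp
    · simpa [hk] using H k hk

theorem State.eq_of_erase_eq {i : ℕ} {x y : State L} (hrow : x.2.1 i = y.2.1 i)
    (herase : x.erase i = y.erase i) : x = y := by
  obtain ⟨hb, H⟩ := State.erase_eq_iff.mp herase
  refine State.ext hb (funext fun k => ?_)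
  by_cases hk : k = i
  · rw [hk, hrow]
  · exact H k hk

theorem State.row_one (x : State L) : x.2.1 1 = 0 :=
  funext fun j => x.2.2.support 1 j (by omega)

/-- A nonempty set of basis indices has an element no shift of which by `δ` lies in the set. -/
theorem exists_forall_shift_notMem [Finite β] {S : Set (State L)} (hS : S.Nonempty) {δ : ℚ}
    (hδ : δ = 1 ∨ δ = -1) : ∃ x ∈ S, ∀ y ∈ S, ∀ i j, y.2.1 ≠ shift x.2.1 i j δ := by
  obtain ⟨x, hx, hmax⟩ := S.toFinite.exists_maximalFor (fun x : State L => δ • x.2.1) S hS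
  refine ⟨x, hx, fun y hy i j hyx => ?_⟩
  have hlt : δ • x.2.1 < δ • y.2.1 := by
    rw [hyx]
    rcases hδ with rfl | rfl
    · rw [one_smul, one_smul]
      exact lt_shift _ i j one_pos
    · rw [neg_smul, neg_smul, one_smul, one_smul, neg_lt_neg_iff]
      exact shift_lt _ i j (by norm_num)
  exact absurd (hmax hy hlt.le) (not_le_of_gt hlt)

variable [DecidableEq β]

/-- The matrix of `I_{k,k-1}` on the direct sum of a family of representations. -/
noncomputable def genMatrix (R : β → Roots h) (L : β → NonclassicalLabel n) (k : Gen n) :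
    Matrix (State L) (State L) ℂ :=
  Matrix.blockDiagonal' fun b =>
    LinearMap.toMatrix Finsupp.basisSingleOne Finsupp.basisSingleOne
      (nonclassicalRep (R b) (L b) k)

theorem genMatrix_apply (k : Gen n) (b : β)
    (η ξ : {ξ : Tableau // IsNonclassicalTableau (L b) ξ}) :
    genMatrix R L k ⟨b, η⟩ ⟨b, ξ⟩ = nonclassicalRep (R b) (L b) k (Finsupp.single ξ 1) η := by
  rw [genMatrix, Matrix.blockDiagonal'_apply_eq, LinearMap.toMatrix_apply]
  simp

theorem genMatrix_ne_zero {k : Gen n} {x y : State L} (H : genMatrix R L k x y ≠ 0) :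
    x.1 = y.1 ∧ ∀ i, i ≠ (k : ℕ) - 1 → x.2.1 i = y.2.1 i := by
  obtain ⟨b, η⟩ := x
  obtain ⟨b', ξ⟩ := y
  by_cases hb : b = b'
  · subst hb
    rw [genMatrix_apply] at H
    exact ⟨rfl, fun i hi => row_eq_of_nonclassicalRep_ne_zero H hi⟩
  · exact absurd (Matrix.blockDiagonal'_apply_ne _ _ _ hb) H

variable [Fintype β]

/-- The algebra generated by the matrices of `I_{21}, …, I_{K,K-1}` on the direct sum of a family
of representations. -/
noncomputable def levelAlgebra (R : β → Roots h) (L : β → NonclassicalLabel n) (K : ℕ) :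
    Subalgebra ℂ (Matrix (State L) (State L) ℂ) :=
  Algebra.adjoin ℂ (genMatrix R L '' {k | (k : ℕ) ≤ K})

theorem levelAlgebra_mono {K K' : ℕ} (hK : K ≤ K') : levelAlgebra R L K ≤ levelAlgebra R L K' :=
  Algebra.adjoin_mono (Set.image_mono fun _ hk => le_trans hk hK)

theorem genMatrix_mem {K : ℕ} {k : Gen n} (hk : (k : ℕ) ≤ K) :
    genMatrix R L k ∈ levelAlgebra R L K :=
  Algebra.subset_adjoin ⟨k, hk, rfl⟩

/-- Indistinguishable basis indices stay indistinguishable under the same shift of an entry. -/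
theorem Indist.shift (hq : ∀ N : ℕ, 0 < N → Complex.exp h ^ N ≠ 1) {K : ℕ} (hK : K + 1 ≤ n)
    (hrows : ∀ x y, Indist (levelAlgebra R L (K + 1)) x y → ∀ i ≤ K, x.2.1 i = y.2.1 i)
    {x y : State L} (H : Indist (levelAlgebra R L (K + 1)) x y) {i j : ℕ} (hi : 2 ≤ i)
    (hiK : i ≤ K) (hj : 1 ≤ j) (hji : j ≤ i / 2) {δ : ℚ} (hδ : δ = 1 ∨ δ = -1)
    (hs : IsNonclassicalTableau (L x.1) (QSO.shift x.2.1 i j δ)) :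
    ∃ hs' : IsNonclassicalTableau (L y.1) (QSO.shift y.2.1 i j δ),
      Indist (levelAlgebra R L (K + 1)) ⟨x.1, ⟨_, hs⟩⟩ ⟨y.1, ⟨_, hs'⟩⟩ := by
  let k : Gen n := ⟨i + 1, by omega, by omega⟩
  have hne := nonclassicalRep_shift_ne_zero hq (R x.1) k hj hji hδ x.2 ⟨_, hs⟩ rfl
  rw [← genMatrix_apply, ← genMatrix_apply] at hne
  obtain ⟨⟨b, η, hη⟩, hind, hy⟩ := H.transport (ρ := fun x : State L => x.2.1 i)
    (c := State.erase i) (genMatrix_mem (k := k) (Nat.succ_le_succ hiK))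
    (fun _ _ h => hrows _ _ h i hiK)
    (fun _ _ h => State.erase_eq_iff.mpr (genMatrix_ne_zero h))
    (fun _ _ => State.eq_of_erase_eq) hne.1 hne.2
  obtain ⟨hb, hr⟩ := genMatrix_ne_zero hy
  obtain rfl : b = y.1 := hb
  have hη' : η = QSO.shift y.2.1 i j δ := by
    funext l
    by_cases hl : l = i
    · subst hl
      exact (hrows _ _ hind l hiK).symm.trans (shift_row_congr (hrows _ _ H l hiK) j δ)
    · rw [shift_row_of_ne _ _ _ hl]
      exact hr l hl
  subst hη'
  exact ⟨hη, hind⟩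

/-- Indistinguishable basis indices can be moved simultaneously, without changing the rows above
row `K`, until no entry of the first one in the rows up to `K` can be shifted by `δ`. -/
theorem Indist.exists_extremal (hq : ∀ N : ℕ, 0 < N → Complex.exp h ^ N ≠ 1) {K : ℕ}
    (hK : K + 1 ≤ n)
    (hrows : ∀ x y, Indist (levelAlgebra R L (K + 1)) x y → ∀ i ≤ K, x.2.1 i = y.2.1 i)
    {x y : State L} (H : Indist (levelAlgebra R L (K + 1)) x y) {δ : ℚ} (hδ : δ = 1 ∨ δ = -1) :
    ∃ x' y' : State L, Indist (levelAlgebra R L (K + 1)) x' y' ∧ x'.1 = x.1 ∧ y'.1 = y.1 ∧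
      (∀ i, K < i → x'.2.1 i = x.2.1 i) ∧ (∀ i, K < i → y'.2.1 i = y.2.1 i) ∧
      ∀ i j, 2 ≤ i → i ≤ K → 1 ≤ j → j ≤ i / 2 →
        ¬ IsNonclassicalTableau (L x'.1) (QSO.shift x'.2.1 i j δ) := by
  obtain ⟨x', ⟨hx, hxr, y', hxy, hy, hyr⟩, hmax⟩ := exists_forall_shift_notMem
    (S := {x' : State L | x'.1 = x.1 ∧ (∀ i, K < i → x'.2.1 i = x.2.1 i) ∧
      ∃ y' : State L, Indist (levelAlgebra R L (K + 1)) x' y' ∧ y'.1 = y.1 ∧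
        ∀ i, K < i → y'.2.1 i = y.2.1 i})
    ⟨x, rfl, fun _ _ => rfl, y, H, rfl, fun _ _ => rfl⟩ hδ
  refine ⟨x', y', hxy, hx, hy, hxr, hyr, fun i j hi hiK hj hji hs => ?_⟩
  obtain ⟨hs', hind⟩ := hxy.shift hq hK hrows hi hiK hj hji hδ hs
  refine hmax ⟨x'.1, _, hs⟩ ⟨hx, fun k hk => ?_, _, hind, hy, fun k hk => ?_⟩ i j rfl
  · exact (shift_row_of_ne _ _ _ (by omega)).trans (hxr k hk)
  · exact (shift_row_of_ne _ _ _ (by omega)).trans (hyr k hk)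

/-- In a tableau whose row `K` is as large as possible this row contains the entries
`m_{1,K+1}, m_{2,K+1}, …`. -/
theorem Indist.succ_row_le (hq : ∀ N : ℕ, 0 < N → Complex.exp h ^ N ≠ 1) {K : ℕ} (hK2 : 2 ≤ K)
    (hK : K + 1 ≤ n)
    (hrows : ∀ x y, Indist (levelAlgebra R L (K + 1)) x y → ∀ i ≤ K, x.2.1 i = y.2.1 i)
    {x y : State L} (H : Indist (levelAlgebra R L (K + 1)) x y) {j : ℕ} (hj : 1 ≤ j)
    (hjK : j ≤ K / 2) : x.2.1 (K + 1) j ≤ y.2.1 (K + 1) j := by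
  obtain ⟨x', y', hxy, -, -, hxr, hyr, hmax⟩ := H.exists_extremal hq hK hrows (Or.inl rfl)
  have h1 := x'.2.2.eq_succ_row_of_forall_not_shift (by omega) hmax K hK2 le_rfl j hj hjK
  have h2 := y'.2.2.le_succ_row hK2 (by omega) hj hjK
  rw [← hrows _ _ hxy K le_rfl, h1] at h2
  rwa [hxr _ (Nat.lt_succ_self K), hyr _ (Nat.lt_succ_self K)] at h2

/-- In a tableau whose row `K` is as small as possible this row contains the entries
`m_{2,K+1}, m_{3,K+1}, …`. -/
theorem Indist.le_succ_row (hq : ∀ N : ℕ, 0 < N → Complex.exp h ^ N ≠ 1) {K : ℕ} (hK2 : 2 ≤ K)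
    (hK : K + 1 ≤ n)
    (hrows : ∀ x y, Indist (levelAlgebra R L (K + 1)) x y → ∀ i ≤ K, x.2.1 i = y.2.1 i)
    {x y : State L} (H : Indist (levelAlgebra R L (K + 1)) x y) {j : ℕ} (hj : 1 ≤ j)
    (hjK : j + 1 ≤ (K + 1) / 2) : y.2.1 (K + 1) (j + 1) ≤ x.2.1 (K + 1) (j + 1) := by
  obtain ⟨x', y', hxy, -, -, hxr, hyr, hmax⟩ := H.exists_extremal hq hK hrows (Or.inr rfl)
  have h1 := x'.2.2.eq_lower_bound_of_forall_not_shift (by omega) hmax K hK2 le_rfl j hj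
    (by omega)
  rw [if_pos hjK] at h1
  have h2 := y'.2.2.succ_row_le hK2 (by omega) hj hjK
  rw [← hrows _ _ hxy K le_rfl, h1] at h2
  rwa [hxr _ (Nat.lt_succ_self K), hyr _ (Nat.lt_succ_self K)] at h2

theorem diagCoeff_congr {ξ η : Tableau} {k : ℕ} (H : ∀ i ≤ k, ξ i = η i) :
    diagCoeff h k ξ = diagCoeff h k η := by
  unfold diagCoeff
  by_cases he : Even k
  · rw [if_pos he, if_pos he]
    exact coeffCHat_congr fun i hi => H i (by omega)
  · rw [if_neg he, if_neg he]
    rw [Nat.not_even_iff_odd, Nat.odd_iff] at he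
    rw [H (2 * (k / 2)) (by omega), coeffD_congr fun i hi => H i (by omega)]

theorem diagCoeff_ne_zero (hq : ∀ N : ℕ, 0 < N → Complex.exp h ^ N ≠ 1)
    {L : NonclassicalLabel n} {ξ : Tableau} (hξ : IsNonclassicalTableau L ξ) {k : ℕ}
    (hk : 2 ≤ k) (hkn : k ≤ n) (hhalf : ¬ Even k → ξ (k - 1) (k / 2) = 1 / 2) :
    diagCoeff h k ξ ≠ 0 := by
  unfold diagCoeff
  split_ifs with he h1
  · exact coeffCHat_ne_zero hq _ _
  · rw [Nat.not_even_iff_odd, Nat.odd_iff] at he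
    exact mul_ne_zero (mul_ne_zero one_ne_zero
      (one_div_ne_zero (qpow_sub_ne_zero hq (by norm_num))))
      (coeffD_ne_zero hq hξ (by omega) (by omega))
  · refine absurd ?_ h1
    rw [← hhalf he]
    rw [Nat.not_even_iff_odd, Nat.odd_iff] at he
    rw [show 2 * (k / 2) = k - 1 by omega]

/-- The generator `I_{21}` acts diagonally, and its eigenvalues determine `ε_2` and the row
`m_2`. -/
theorem Indist.level_two (hq : ∀ N : ℕ, 0 < N → Complex.exp h ^ N ≠ 1) (hn : 2 ≤ n)
    {x y : State L} (H : Indist (levelAlgebra R L 2) x y) :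
    (∀ i ≤ 2, x.2.1 i = y.2.1 i) ∧
      ∀ k : Gen n, (k : ℕ) ≤ 2 → (L x.1).ε k = (L y.1).ε k := by
  let k : Gen n := ⟨2, le_rfl, hn⟩
  have hdiag : genMatrix R L k = Matrix.diagonal fun x => genMatrix R L k x x := by
    ext x y
    by_cases hxy : x = y
    · subst hxy; rw [Matrix.diagonal_apply_eq]
    · rw [Matrix.diagonal_apply_ne _ hxy]
      by_contra hne
      exact hxy (State.eq_of_erase_eq (i := 1) (by rw [State.row_one, State.row_one])
        (State.erase_eq_iff.mpr (genMatrix_ne_zero hne)))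
  have hval : ∀ x : State L, genMatrix R L k x x =
      (((L x.1).ε k : ℤ) : ℂ) * qnumPlus h (x.2.1 2 1) := by
    rintro ⟨b, ξ⟩
    rw [genMatrix_apply, nonclassicalRep_apply_self, diagCoeff, if_pos even_two]
    simp [k, coeffCHat, lc]
  have hmem := genMatrix_mem (R := R) (L := L) (k := k) le_rfl
  rw [hdiag] at hmem
  have hxy := H _ hmem
  simp only [hval] at hxy
  have hpos : ∀ x : State L, 0 < x.2.1 2 1 := fun x =>
    lt_of_lt_of_le (by norm_num) (x.2.2.half_le hn le_rfl le_rfl)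
  obtain ⟨h1, h2⟩ := unit_mul_qnumPlus_inj hq (hpos x) (hpos y) hxy
  refine ⟨fun i hi => funext fun j => ?_, fun k' hk' => ?_⟩
  · by_cases hij : i = 2 ∧ j = 1
    · rw [hij.1, hij.2, h2]
    · rw [x.2.2.support i j (by omega), y.2.2.support i j (by omega)]
  · obtain rfl : k' = k := Subtype.ext (le_antisymm hk' k'.2.1)
    exact h1

/-- The algebra generated by `I_{21}, …, I_{K,K-1}` separates basis indices with different rows
up to `K` or different signs `ε_2, …, ε_K`. -/
theorem Indist.rows_eq_and_sign_eq (hq : ∀ N : ℕ, 0 < N → Complex.exp h ^ N ≠ 1) {K : ℕ}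
    (hK2 : 2 ≤ K) (hKn : K ≤ n) (x y : State L) (H : Indist (levelAlgebra R L K) x y) :
    (∀ i ≤ K, x.2.1 i = y.2.1 i) ∧
      ∀ k : Gen n, (k : ℕ) ≤ K → (L x.1).ε k = (L y.1).ε k := by
  revert hKn x y
  induction K, hK2 using Nat.le_induction with
  | base => exact fun hn x y H => H.level_two hq hn
  | succ K hK2 ih =>
    intro hK
    have hrows : ∀ x y : State L, Indist (levelAlgebra R L (K + 1)) x y →
        ∀ i ≤ K, x.2.1 i = y.2.1 i :=
      fun x y H => (ih (by omega) x y (H.mono (levelAlgebra_mono (Nat.le_succ K)))).1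
    have hrows' : ∀ x y : State L, Indist (levelAlgebra R L (K + 1)) x y →
        ∀ i ≤ K + 1, x.2.1 i = y.2.1 i := by
      intro x y H i hi
      rcases Nat.lt_or_ge K i with hiK | hiK
      · obtain rfl : i = K + 1 := by omega
        funext j
        by_cases hj : 1 ≤ j ∧ j ≤ (K + 1) / 2
        · obtain ⟨hj1, hj2⟩ := hj
          rcases Nat.lt_or_ge 1 j with hj3 | hj3
          · obtain ⟨j, rfl⟩ : ∃ j', j = j' + 1 := ⟨j - 1, by omega⟩
            exact le_antisymm (H.symm.le_succ_row hq hK2 hK hrows (by omega) hj2)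
              (H.le_succ_row hq hK2 hK hrows (by omega) hj2)
          · exact le_antisymm (H.succ_row_le hq hK2 hK hrows hj1 (by omega))
              (H.symm.succ_row_le hq hK2 hK hrows hj1 (by omega))
        · rw [x.2.2.support _ j (by omega), y.2.2.support _ j (by omega)]
      · exact hrows x y H i hiK
    refine fun x y H => ⟨hrows' x y H, fun k hk => ?_⟩
    rcases Nat.lt_or_ge K k with hkK | hkK
    · -- The sign is read off from the diagonal entries at tableaux with minimal row `K`, where
      -- these entries do not vanish.
      have hkK' : (k : ℕ) = K + 1 := by omega
      obtain ⟨x', y', hxy, hx, hy, -, -, hmin⟩ := H.exists_extremal hq hK hrows (Or.inr rfl)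
      have hdiag := hxy.diag_eq (ρ := fun x : State L => x.2.1 ((k : ℕ) - 1))
        (c := State.erase ((k : ℕ) - 1)) (genMatrix_mem hk)
        (fun _ _ h => hrows _ _ h _ (by omega))
        (fun _ _ h => State.erase_eq_iff.mpr (genMatrix_ne_zero h))
        (fun _ _ => State.eq_of_erase_eq)
      have hne : diagCoeff h k x'.2.1 ≠ 0 := by
        refine diagCoeff_ne_zero hq x'.2.2 k.2.1 k.2.2 fun hodd => ?_
        rw [Nat.not_even_iff_odd, Nat.odd_iff] at hodd
        rw [show (k : ℕ) - 1 = K by omega, x'.2.2.eq_lower_bound_of_forall_not_shift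
          (by omega) hmin K hK2 le_rfl _ (by omega) (by omega), if_neg (by omega)]
      have hval : ∀ x : State L, genMatrix R L k x x =
          (((L x.1).ε k : ℤ) : ℂ) * diagCoeff h k x.2.1 := by
        rintro ⟨b, ξ⟩
        rw [genMatrix_apply, nonclassicalRep_apply_self]
      rw [hval, hval, ← diagCoeff_congr (fun i hi => hrows' _ _ hxy i (by omega))] at hdiag
      have := mul_right_cancel₀ hne hdiag
      rw [← hx, ← hy]
      exact Units.ext (by exact_mod_cast this)
    · exact (ih (by omega) x y (H.mono (levelAlgebra_mono (Nat.le_succ K)))).2 k hkK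

theorem Indist.label_eq_and_tableau_eq (hq : ∀ N : ℕ, 0 < N → Complex.exp h ^ N ≠ 1)
    (hn : 2 ≤ n) {x y : State L} (H : Indist (levelAlgebra R L n) x y) :
    L x.1 = L y.1 ∧ x.2.1 = y.2.1 := by
  obtain ⟨hrows, hsign⟩ := Indist.rows_eq_and_sign_eq hq hn le_rfl x y H
  refine ⟨NonclassicalLabel.ext (funext fun k => hsign k k.2.2) (funext fun j => ?_),
    funext fun i => ?_⟩
  · rw [← x.2.2.top, ← y.2.2.top, hrows n le_rfl]
  · rcases Nat.lt_or_ge n i with hi | hi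
    · funext j
      rw [x.2.2.support i j (by omega), y.2.2.support i j (by omega)]
    · exact hrows i hi

end Separation

/-! ### Irreducibility and inequivalence -/

section Representations

variable {β : Type} [Fintype β] [DecidableEq β] {n : ℕ} {h : ℂ} {R : β → Roots h}
  {L : β → NonclassicalLabel n}

/-- The elements of the matrix algebra generated by `I_{21}, …, I_{K,K-1}` come from operators on
the single representations which preserve invariant subspaces and commute with intertwiners. -/
theorem exists_operators_of_mem_levelAlgebra {K : ℕ} {A : Matrix (State L) (State L) ℂ}
    (hA : A ∈ levelAlgebra R L K) :
    ∃ T : ∀ b, Module.End ℂ (NonclassicalSpace (L b)),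
      A = Matrix.blockDiagonal' (fun b =>
        LinearMap.toMatrix Finsupp.basisSingleOne Finsupp.basisSingleOne (T b)) ∧
      (∀ b (W : Submodule ℂ (NonclassicalSpace (L b))),
        (∀ k, ∀ v ∈ W, nonclassicalRep (R b) (L b) k v ∈ W) → ∀ v ∈ W, T b v ∈ W) ∧
      ∀ b b' (φ : NonclassicalSpace (L b) →ₗ[ℂ] NonclassicalSpace (L b')),
        (∀ k v, φ (nonclassicalRep (R b) (L b) k v) = nonclassicalRep (R b') (L b') k (φ v)) →
          ∀ v, φ (T b v) = T b' (φ v) := by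
  induction hA using Algebra.adjoin_induction with
  | mem A hA =>
    obtain ⟨k, -, rfl⟩ := hA
    exact ⟨fun b => nonclassicalRep (R b) (L b) k, rfl, fun b W hW => hW k,
      fun b b' φ hφ => hφ k⟩
  | algebraMap r =>
    refine ⟨fun b => r • LinearMap.id, ?_, fun b W _ v hv => W.smul_mem r hv,
      fun b b' φ _ v => by simp⟩
    have : (fun b => LinearMap.toMatrix Finsupp.basisSingleOne Finsupp.basisSingleOne
        (r • (LinearMap.id : Module.End ℂ (NonclassicalSpace (L b))))) = r • 1 := by
      funext b
      rw [map_smul, LinearMap.toMatrix_id]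
      rfl
    rw [this, Matrix.blockDiagonal'_smul, Matrix.blockDiagonal'_one, Algebra.algebraMap_eq_smul_one]
  | add A B _ _ ihA ihB =>
    obtain ⟨S, hS, hSW, hSφ⟩ := ihA
    obtain ⟨T, hT, hTW, hTφ⟩ := ihB
    refine ⟨fun b => S b + T b, ?_, fun b W hW v hv => ?_, fun b b' φ hφ v => ?_⟩
    · rw [hS, hT, ← Matrix.blockDiagonal'_add]
      congr 1
    · exact W.add_mem (hSW b W hW v hv) (hTW b W hW v hv)
    · simp [hSφ b b' φ hφ, hTφ b b' φ hφ]
  | mul A B _ _ ihA ihB =>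
    obtain ⟨S, hS, hSW, hSφ⟩ := ihA
    obtain ⟨T, hT, hTW, hTφ⟩ := ihB
    refine ⟨fun b => S b * T b, ?_, fun b W hW v hv => ?_, fun b b' φ hφ v => ?_⟩
    · rw [hS, hT, ← Matrix.blockDiagonal'_mul]
      congr 1
      funext b
      exact (LinearMap.toMatrix_mul _ _ _).symm
    · exact hSW b W hW _ (hTW b W hW v hv)
    · simp [hSφ b b' φ hφ, hTφ b b' φ hφ]

/-- The projections to the basis vectors with a given label and tableau preserve invariant
subspaces and commute with intertwiners. -/
theorem exists_projection (hq : ∀ N : ℕ, 0 < N → Complex.exp h ^ N ≠ 1) (hn : 2 ≤ n)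
    (R : β → Roots h) (x : State L) :
    ∃ T : ∀ b, Module.End ℂ (NonclassicalSpace (L b)),
      (∀ b v, L b ≠ L x.1 → T b v = 0) ∧ (∀ v, T x.1 v = v x.2 • Finsupp.single x.2 1) ∧
      (∀ b (W : Submodule ℂ (NonclassicalSpace (L b))),
        (∀ k, ∀ v ∈ W, nonclassicalRep (R b) (L b) k v ∈ W) → ∀ v ∈ W, T b v ∈ W) ∧
      ∀ b b' (φ : NonclassicalSpace (L b) →ₗ[ℂ] NonclassicalSpace (L b')),
        (∀ k v, φ (nonclassicalRep (R b) (L b) k v) = nonclassicalRep (R b') (L b') k (φ v)) →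
          ∀ v, φ (T b v) = T b' (φ v) := by
  obtain ⟨T, hT, hTW, hTφ⟩ := exists_operators_of_mem_levelAlgebra
    (diagonal_classIndicator_mem (levelAlgebra R L n) x)
  have hsingle : ∀ b η, T b (Finsupp.single η 1) =
      classIndicator (levelAlgebra R L n) x ⟨b, η⟩ • Finsupp.single η 1 := by
    intro b η
    ext ζ
    have h1 := congrFun (congrFun hT ⟨b, ζ⟩) ⟨b, η⟩
    rw [Matrix.blockDiagonal'_apply_eq, LinearMap.toMatrix_apply] at h1
    simp only [Finsupp.coe_basisSingleOne, Finsupp.basisSingleOne_repr,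
      LinearEquiv.refl_apply] at h1
    rw [← h1]
    by_cases hζ : ζ = η
    · subst hζ; simp
    · rw [Matrix.diagonal_apply_ne _ (by simpa using hζ)]
      simp [hζ]
  refine ⟨T, fun b v hb => ?_, fun v => ?_, hTW, hTφ⟩
  · have : T b = 0 := by
      refine Finsupp.lhom_ext' fun η => LinearMap.ext_ring ?_
      simp only [LinearMap.comp_apply, Finsupp.lsingle_apply, LinearMap.zero_apply]
      rw [hsingle, classIndicator, if_neg, zero_smul]
      exact fun H => hb (H.label_eq_and_tableau_eq hq hn).1.symm
    rw [this, LinearMap.zero_apply]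
  · have : T x.1 = (Finsupp.lsingle x.2).comp (Finsupp.lapply x.2) := by
      refine Finsupp.lhom_ext' fun η => LinearMap.ext_ring ?_
      simp only [LinearMap.comp_apply, Finsupp.lsingle_apply, Finsupp.lapply_apply]
      rw [hsingle]
      by_cases hη : η = x.2
      · subst hη
        rw [classIndicator_of_indist (Indist.refl _ x)]
        simp
      · rw [classIndicator, if_neg, zero_smul, Finsupp.single_eq_of_ne (Ne.symm hη),
          Finsupp.single_zero]
        exact fun H => hη (Subtype.ext (H.label_eq_and_tableau_eq hq hn).2.symm)
    rw [this]
    simp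

/-- A tableau in which no entry can be raised is constant along the columns, hence determined by
its top row. -/
theorem IsNonclassicalTableau.eq_of_forall_not_shift {L : NonclassicalLabel n} {ξ η : Tableau}
    (hξ : IsNonclassicalTableau L ξ) (hη : IsNonclassicalTableau L η)
    (H : ∀ i j, 2 ≤ i → i < n → 1 ≤ j → j ≤ i / 2 → ¬ IsNonclassicalTableau L (shift ξ i j 1))
    (H' : ∀ i j, 2 ≤ i → i < n → 1 ≤ j → j ≤ i / 2 → ¬ IsNonclassicalTableau L (shift η i j 1)) :
    ξ = η := by
  funext k j
  by_cases hkj : 2 ≤ k ∧ k ≤ n ∧ 1 ≤ j ∧ j ≤ k / 2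
  · obtain ⟨hk, hkn, hj, hjk⟩ := hkj
    revert hk hjk
    induction hkn using Nat.decreasingInduction with
    | self => intro _ _; rw [hξ.top, hη.top]
    | of_succ k hkn ih =>
      intro hk hjk
      have hlt : n - 1 < n := by omega
      rw [hξ.eq_succ_row_of_forall_not_shift hlt
          (fun i j hi hin => H i j hi (by omega)) k hk (by omega) j hj hjk,
        hη.eq_succ_row_of_forall_not_shift hlt
          (fun i j hi hin => H' i j hi (by omega)) k hk (by omega) j hj hjk]
      exact ih (by omega) (by omega)
  · rw [hξ.support k j hkj, hη.support k j hkj]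

theorem isIrreducible_nonclassicalRep (hq : ∀ N : ℕ, 0 < N → Complex.exp h ^ N ≠ 1) (hn : 2 ≤ n)
    (R : Roots h) (L : NonclassicalLabel n) : IsIrreducible (nonclassicalRep R L) := by
  obtain ⟨ξ₀⟩ := nonempty_nonclassicalTableaux hn L
  refine ⟨⟨Finsupp.single ξ₀ 1, 0, by simp⟩, fun W hW => ?_⟩
  rw [or_iff_not_imp_left]
  intro hne
  have hproj : ∀ v ∈ W, ∀ ξ, v ξ ≠ 0 → Finsupp.single ξ 1 ∈ W := by
    intro v hv ξ hξ
    obtain ⟨T, -, hT, hTW, -⟩ := exists_projection (β := Unit) (L := fun _ => L) hq hn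
      (fun _ => R) ⟨(), ξ⟩
    have := hTW () W hW v hv
    rw [hT v] at this
    exact (W.smul_mem_iff hξ).mp this
  -- Membership of basis vectors in `W` is invariant under shifts of the tableaux.
  have hmove : ∀ ξ η : {ξ : Tableau // IsNonclassicalTableau L ξ}, ∀ i j, 2 ≤ i → i < n →
      1 ≤ j → j ≤ i / 2 → η.1 = shift ξ.1 i j 1 →
      (Finsupp.single ξ 1 ∈ W ↔ Finsupp.single η 1 ∈ W) := by
    intro ξ η i j hi hin hj hji hη
    obtain ⟨h1, h2⟩ := nonclassicalRep_shift_ne_zero hq R (k := ⟨i + 1, by omega, by omega⟩) hj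
      hji (Or.inl rfl) ξ η hη
    exact ⟨fun h => hproj _ (hW _ _ h) _ h1, fun h => hproj _ (hW _ _ h) _ h2⟩
  obtain ⟨v, hv, hv0⟩ := W.ne_bot_iff.mp hne
  obtain ⟨ξ, hξ⟩ := Finsupp.ne_iff.mp hv0
  have hξW := hproj v hv ξ hξ
  have hall : ∀ η, Finsupp.single η 1 ∈ W := by
    intro η
    by_contra hη
    -- Both the tableaux in `W` and those outside contain one which is maximal under raising.
    obtain ⟨a, ha, hamax⟩ := exists_forall_shift_notMem (L := fun _ : Unit => L)
      (S := {x | Finsupp.single x.2 1 ∈ W}) ⟨⟨(), ξ⟩, hξW⟩ (Or.inl rfl)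
    obtain ⟨b, hb, hbmax⟩ := exists_forall_shift_notMem (L := fun _ : Unit => L)
      (S := {x | Finsupp.single x.2 1 ∉ W}) ⟨⟨(), η⟩, hη⟩ (Or.inl rfl)
    have hab : a.2 = b.2 := Subtype.ext <| a.2.2.eq_of_forall_not_shift b.2.2
      (fun i j hi hin hj hji hs => hamax ⟨(), _, hs⟩
        ((hmove a.2 ⟨_, hs⟩ i j hi hin hj hji rfl).mp ha) i j rfl)
      (fun i j hi hin hj hji hs => hbmax ⟨(), _, hs⟩
        (fun h => hb ((hmove b.2 ⟨_, hs⟩ i j hi hin hj hji rfl).mpr h)) i j rfl)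
    exact hb (hab ▸ ha)
  rw [eq_top_iff]
  intro w _
  rw [← Finsupp.sum_single w]
  refine W.sum_mem fun η _ => ?_
  have := W.smul_mem (w η) (hall η)
  rwa [Finsupp.smul_single, smul_eq_mul, mul_one] at this

theorem not_equivalent_of_label_ne (hq : ∀ N : ℕ, 0 < N → Complex.exp h ^ N ≠ 1) (hn : 2 ≤ n)
    (R R' : Roots h) (L L' : NonclassicalLabel n) (hne : L ≠ L') :
    ¬ Equivalent (nonclassicalRep R L) (nonclassicalRep R' L') := by
  rintro ⟨φ, hφ⟩
  obtain ⟨ξ⟩ := nonempty_nonclassicalTableaux hn L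
  obtain ⟨T, hT0, hT, -, hTφ⟩ := exists_projection (L := fun b : Bool => bif b then L' else L)
    hq hn (fun b => bif b then R' else R) ⟨false, ξ⟩
  have h1 := hTφ false true φ.toLinearMap hφ (Finsupp.single ξ 1)
  rw [hT0 true _ (Ne.symm hne), hT] at h1
  simp at h1

/-- The operator `T(I_{21})` of the classical type is diagonal. -/
theorem classicalRep_two_apply (R : Roots h) (M : ClassicalLabel n) {k : Gen n}
    (hk : (k : ℕ) = 2) (v : ClassicalSpace M) (ξ : {ξ : Tableau // IsClassicalTableau M ξ}) :
    classicalRep R M k v ξ = Complex.I * qnum h (ξ.1 2 1) * v ξ := by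
  classical
  induction v using Finsupp.induction_linear with
  | zero => simp
  | add v w hv hw => rw [map_add, Finsupp.add_apply, hv, hw, Finsupp.add_apply, mul_add]
  | single η a =>
    rw [classicalRep, Finsupp.linearCombination_single, hk, if_pos even_two]
    have hC : coeffC h 1 η.1 = qnum h (η.1 2 1) := by simp [coeffC, lc]
    simp only [classicalEven, Nat.reduceDiv, Nat.sub_self, Finset.Icc_eq_empty_of_lt one_pos,
      Finset.sum_empty, sub_zero, zero_add, hC, Finsupp.smul_apply, ket_apply]
    by_cases hη : η = ξ
    · subst hη
      simp [mul_comm]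
    · rw [if_neg fun h => hη (Subtype.ext h), Finsupp.single_eq_of_ne (Ne.symm hη)]
      simp

/-- The eigenvalues of `I_{21}` distinguish the two types. -/
theorem not_equivalent_classicalRep (hq : ∀ N : ℕ, 0 < N → Complex.exp h ^ N ≠ 1) (hn : 2 ≤ n)
    (R R' : Roots h) (L : NonclassicalLabel n) (M : ClassicalLabel n) :
    ¬ Equivalent (nonclassicalRep R L) (classicalRep R' M) := by
  rintro ⟨φ, hφ⟩
  obtain ⟨ξ⟩ := nonempty_nonclassicalTableaux hn L
  let k : Gen n := ⟨2, le_rfl, hn⟩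
  have heig : nonclassicalRep R L k (Finsupp.single ξ 1) =
      (((L.ε k : ℤ) : ℂ) * qnumPlus h (ξ.1 2 1)) • Finsupp.single ξ 1 := by
    have hC : diagCoeff h 2 ξ.1 = qnumPlus h (ξ.1 2 1) := by
      rw [diagCoeff, if_pos even_two]
      simp [coeffCHat, lc]
    rw [nonclassicalRep_single]
    simp [k, hC, ket, ξ.2]
  have hne : φ (Finsupp.single ξ 1) ≠ 0 := by simp
  obtain ⟨η, hη⟩ := Finsupp.ne_iff.mp hne
  have h1 := DFunLike.congr_fun (hφ k (Finsupp.single ξ 1)) η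
  rw [heig, map_smul, Finsupp.smul_apply, smul_eq_mul, classicalRep_two_apply R' M rfl] at h1
  exact unit_mul_qnumPlus_ne hq _ _ _ (mul_right_cancel₀ hη h1)

end Representations

end QSO

theorem theorem1 (n : ℕ) (hn : 3 ≤ n) (h : ℂ)
    (hq : ∀ N : ℕ, 0 < N → Complex.exp h ^ N ≠ 1) :
    (∀ (R : QSO.Roots h) (L : QSO.NonclassicalLabel n),
      QSO.IsIrreducible (QSO.nonclassicalRep R L)) ∧
    (∀ (R R' : QSO.Roots h) (L L' : QSO.NonclassicalLabel n), L ≠ L' →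
      ¬ QSO.Equivalent (QSO.nonclassicalRep R L) (QSO.nonclassicalRep R' L')) ∧
    (∀ (R R' : QSO.Roots h) (L : QSO.NonclassicalLabel n) (M : QSO.ClassicalLabel n),
      ¬ QSO.Equivalent (QSO.nonclassicalRep R L) (QSO.classicalRep R' M)) :=
  have hn2 : 2 ≤ n := le_trans (by norm_num) hn
  ⟨fun R L => QSO.isIrreducible_nonclassicalRep hq hn2 R L,
    fun R R' L L' hne => QSO.not_equivalent_of_label_ne hq hn2 R R' L L' hne,
    fun R R' L M => QSO.not_equivalent_classicalRep hq hn2 R R' L M⟩
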